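/- **Theorem (Genus Expansion Ansatz).** For partitions $\alpha,\beta$ of $d\ge 1$ and $g\ge 0$ let $r=r^g_{\alpha,\beta}=-2+2g+l(\alpha)+l(\beta)$, where $l$ denotes the number of parts, and let $H^g_{\alpha,\beta}$ be the double Hurwitz number (the weighted count of connected genus $g$ degree $d$ branched covers of $\mathbb{CP}^1$ with branching $\alpha,\beta$ over two points, the preimages of these two points being labelled, and simple branching over $r$ further points), given through monodromy by the Hurwitz axioms: $H^g_{\alpha,\beta}$ is $|\operatorname{Aut}\alpha|\,|\operatorname{Aut}\beta|/d!$ times the number of tuples $(\sigma,\tau_1,\dots,\tau_r,\gamma)$ of permutations in $\mathfrak S_d$ such that $\sigma$ has cycle type $\beta$, $\gamma$ has cycle type $\alpha$, the $\tau_i$ are transpositions, $\tau_r\cdots\tau_1\sigma=\gamma$, and $\sigma,\tau_1,\dots,\tau_r$ generate a transitive subgroup of $\mathfrak S_d$. Here $|\operatorname{Aut}\theta|=\prod_{i}a_i!$ if $\theta$ has $a_i$ parts equal to $i$. Let $q_1,q_2,\dots$ and $u$ be indeterminates, $q_\beta=\prod_i q_{\beta_i}$, and let $$\mathbf H_1^g(x)=\sum_{d\ge1}\sum_{\beta\vdash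 d}x^d\,q_\beta\,u^{l(\beta)}\,\frac{H^g_{(d),\beta}}{r^g_{(d),\beta}!\,|\operatorname{Aut}\beta|}$$ be the genus $g$ one-part double Hurwitz series. Put $Q(t)=\sum_{j\ge1}q_jt^j$ and $Q^{(i)}(t)=\left(t\frac{d}{dt}\right)^iQ(t)=\sum_{j\ge1}q_jj^it^j$. For a partition $\theta=(\theta_1,\theta_2,\dots)$ let $2\theta=(2\theta_1,2\theta_2,\dots)$, $Q^{(2\theta)}=\prod_iQ^{(2\theta_i)}$ and $v_{2\theta}=\prod_iv_{2\theta_i}$ (empty products are $1$), where $$\frac2x\sinh\frac x2=\sum_{j\ge0}v_{2j}x^{2j},\qquad \frac{x/2}{\sinh(x/2)}=\sum_{j\ge0}f_{2j}x^{2j}.$$ Then the functional equation $w=x\,e^{Q(w)}$ has a unique formal power series solution $w=w(x)\in\mathbb Q[q_1,q_2,\dots][[x]]$ with zero constant term, and for every $g\ge0$ $$\mathbf H_1^g(x)\Big|_{u=1}=\sum_{k=0}^g f_{2k}\sum_{\theta\vdash g-k}\frac{v_{2\theta}}{|\operatorname{Aut}\theta|}\left(x\frac d{dx}\right)^{2g-2+l(\theta)}\left(\frac{Q^{(2\theta)}(w)}{1-Q^{(1)}(w)}-\delta_{\theta\emptyset}\right).$$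 Here $\delta_{\theta\emptyset}$ is $1$ if $\theta$ is the empty partition and $0$ otherwise, and for every integer $m$ the operator $\left(x\frac d{dx}\right)^m$ acts on power series in $x$ without constant term (such as the ones in parentheses) by multiplying the coefficient of $x^d$ by $d^m$; a negative exponent occurs only for $g=0$, where $m=-2$. -/

import Mathlib

open PowerSeries

noncomputable section

namespace OnePartHurwitz

/-! ### Partitions -/

/-- The order `∏ᵢ aᵢ!` of the group of permutations of the positions of a partition that fix it,
where `aᵢ` is the number of parts equal to `i`. -/
def autCard {d : ℕ} (θ : Nat.Partition d) : ℕ :=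
  ∏ i ∈ θ.parts.toFinset, (θ.parts.count i).factorial

/-- The number `l(θ)` of parts of `θ`. -/
def len {d : ℕ} (θ : Nat.Partition d) : ℕ := θ.parts.card

/-! ### Double Hurwitz numbers -/

/-- `r = -2 + 2g + l(α) + l(β)`; for `d ≥ 1` both lengths are positive, so that the subtraction
does not truncate. -/
def simpleCount (g : ℕ) {d : ℕ} (α β : Nat.Partition d) : ℕ :=
  2 * g + len α + len β - 2

/-- The transitive ordered factorizations `(σ, τ₁, …, τᵣ, γ)`: `σ ∈ C_β`, `γ ∈ C_α`, the `τᵢ` are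
transpositions, `τᵣ ⋯ τ₁ σ = γ`, and `σ, τ₁, …, τᵣ` generate a transitive subgroup of `𝔖_d`.
(`Equiv.Perm.partition` is the full cycle type, fixed points included.) -/
def TransitiveFactorizations (g : ℕ) {d : ℕ} (α β : Nat.Partition d) :
    Set (Equiv.Perm (Fin d) × (Fin (simpleCount g α β) → Equiv.Perm (Fin d)) ×
      Equiv.Perm (Fin d)) :=
  {p | p.1.partition.parts = β.parts ∧
    p.2.2.partition.parts = α.parts ∧
    (∀ i, (p.2.1 i).IsSwap) ∧
    (List.ofFn p.2.1).reverse.prod * p.1 = p.2.2 ∧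
    MulAction.IsPretransitive
      (Subgroup.closure (insert p.1 (Set.range p.2.1))) (Fin d)}

/-- The double Hurwitz number `H^g_{α,β}`: the number of connected genus `g` branched covers of the
sphere with branching `α`, `β` over two points and simple branching over `r` further points,
given through monodromy. -/
def doubleHurwitz (g : ℕ) {d : ℕ} (α β : Nat.Partition d) : ℚ :=
  (autCard α * autCard β : ℚ) / d.factorial * (TransitiveFactorizations g α β).ncard

/-! ### Generating series -/

/-- The ring `ℚ[q₁, q₂, …]` (the variable with index `0` never occurs). -/
abbrev QRing : Type := MvPolynomial ℕ ℚ

/-- The monomial `q_β`. -/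
def qMon {d : ℕ} (β : Nat.Partition d) : QRing := (β.parts.map MvPolynomial.X).prod

/-- The one-part genus `g` series
`H₁^g(x) = ∑_{d ≥ 1} ∑_{β ⊢ d} x^d q_β u^{l(β)} H^g_{(d),β} / (r! |Aut β|)`,
a power series in `x` over `ℚ[q₁, q₂, …][u]`. -/
def onePartSeriesU (g : ℕ) : PowerSeries (Polynomial QRing) :=
  PowerSeries.mk fun d =>
    if d = 0 then 0 else
      ∑ β : Nat.Partition d,
        Polynomial.monomial (len β)
          (MvPolynomial.C
            (doubleHurwitz g (Nat.Partition.indiscrete d) β /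
              ((simpleCount g (Nat.Partition.indiscrete d) β).factorial * autCard β)) * qMon β)

/-- `H₁^g(x)` at `u = 1`. -/
def onePartSeries (g : ℕ) : PowerSeries QRing :=
  PowerSeries.map (Polynomial.evalRingHom 1) (onePartSeriesU g)

/-- `Q(t) = ∑_{j ≥ 1} q_j t^j`. -/
def Q : PowerSeries QRing :=
  PowerSeries.mk fun j => if j = 0 then 0 else MvPolynomial.X j

/-- The operator `x d/dx`. -/
def euler (f : PowerSeries QRing) : PowerSeries QRing :=
  PowerSeries.X * PowerSeries.derivative QRing f

/-- `Q^{(i)} = (x d/dx)^i Q`. -/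
def QDer (i : ℕ) : PowerSeries QRing := euler^[i] Q

/-- `Q^{(i)}(w)`, for a series `w` without constant term. -/
def QDerAt (w : PowerSeries QRing) (i : ℕ) : PowerSeries QRing := (QDer i).subst w

/-- `Q^{(2θ)}(w) = ∏ᵢ Q^{(2θᵢ)}(w)`. -/
def QPartAt (w : PowerSeries QRing) {n : ℕ} (θ : Nat.Partition n) : PowerSeries QRing :=
  (θ.parts.map fun i => QDerAt w (2 * i)).prod

/-- `w` solves the functional equation `w = x e^{Q(w)}`. -/
def IsLagrangeSolution (w : PowerSeries QRing) : Prop :=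
  constantCoeff w = 0 ∧
    w = PowerSeries.X * (PowerSeries.exp QRing).subst ((Q.subst w : PowerSeries QRing))

/-- The series `Q^{(2θ)}(w) / (1 - Q^{(1)}(w)) - δ_{θ∅}`; the inverse is that of a power series
with constant term `1`. -/
def bracket (w : PowerSeries QRing) {n : ℕ} (θ : Nat.Partition n) : PowerSeries QRing :=
  QPartAt w θ * PowerSeries.invOfUnit (1 - QDerAt w 1) 1 - if θ.parts = 0 then 1 else 0

/-- The operator `(x d/dx)^m` for an integer `m`, which multiplies the coefficient of `x^d` by
`d^m`. For `m < 0` it is the inverse of `(x d/dx)^{-m}` on the series without constant term. -/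
def eulerPow (m : ℤ) (f : PowerSeries QRing) : PowerSeries QRing :=
  PowerSeries.mk fun d => MvPolynomial.C ((d : ℚ) ^ m) * coeff d f

/-! ### The coefficients `v` and `f` -/

/-- `(2/x) sinh(x/2)`, that is `(e^{x/2} - e^{-x/2}) / x`. -/
def sinhQuot : PowerSeries ℚ :=
  PowerSeries.mk fun n =>
    coeff (n + 1) (rescale (1 / 2 : ℚ) (exp ℚ) - rescale (-1 / 2 : ℚ) (exp ℚ))

/-- `v_m = [x^m] (2/x) sinh(x/2)`. -/
def vCoeff (m : ℕ) : ℚ := coeff m sinhQuot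

/-- `f_m = [x^m] (x/2) / sinh(x/2)`. -/
def fCoeff (m : ℕ) : ℚ := coeff m sinhQuot⁻¹

/-- `v_{2θ} = ∏ᵢ v_{2θᵢ}`. -/
def vPart {n : ℕ} (θ : Nat.Partition n) : ℚ :=
  (θ.parts.map fun i => vCoeff (2 * i)).prod

/-! ### The divisions and inverses above are genuine -/

lemma X_mul_sinhQuot :
    PowerSeries.X * sinhQuot = rescale (1 / 2 : ℚ) (exp ℚ) - rescale (-1 / 2 : ℚ) (exp ℚ) := by
  ext n
  cases n with
  | zero =>
    rw [coeff_zero_X_mul, map_sub, coeff_rescale, coeff_rescale]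
    simp
  | succ n => rw [coeff_succ_X_mul, sinhQuot, coeff_mk]

lemma constantCoeff_sinhQuot : constantCoeff sinhQuot = 1 := by
  rw [← coeff_zero_eq_constantCoeff_apply, sinhQuot, coeff_mk]
  simp [coeff_rescale, coeff_exp]
  norm_num

lemma sinhQuot_mul_inv : sinhQuot * sinhQuot⁻¹ = 1 :=
  PowerSeries.mul_inv_cancel _ (by rw [constantCoeff_sinhQuot]; exact one_ne_zero)

lemma coeff_euler (f : PowerSeries QRing) (d : ℕ) :
    coeff d (euler f) = (d : QRing) * coeff d f := by
  cases d with
  | zero => simp [euler]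
  | succ d =>
    rw [euler, coeff_succ_X_mul, PowerSeries.coeff_derivative, mul_comm]
    push_cast
    rfl

lemma coeff_iterate_euler (n : ℕ) (f : PowerSeries QRing) (d : ℕ) :
    coeff d (euler^[n] f) = (d : QRing) ^ n * coeff d f := by
  induction n with
  | zero => simp
  | succ n ih => rw [Function.iterate_succ_apply', coeff_euler, ih]; ring

lemma eulerPow_natCast (n : ℕ) (f : PowerSeries QRing) : eulerPow n f = euler^[n] f := by
  ext1 d
  rw [coeff_iterate_euler, eulerPow, coeff_mk]
  simp

lemma iterate_euler_eulerPow_neg (n : ℕ) (f : PowerSeries QRing) (hf : constantCoeff f = 0) :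
    euler^[n] (eulerPow (-n) f) = f := by
  ext1 d
  rw [coeff_iterate_euler, eulerPow, coeff_mk]
  rcases Nat.eq_zero_or_pos d with rfl | hd
  · simp [hf]
  · have h : (d : ℚ) ≠ 0 := by positivity
    have h2 : (d : QRing) = MvPolynomial.C (d : ℚ) := by simp
    rw [h2, ← mul_assoc, ← map_pow, ← map_mul]
    simp [h]

lemma constantCoeff_QDerAt (w : PowerSeries QRing) (hw : constantCoeff w = 0) (i : ℕ) :
    constantCoeff (QDerAt w i) = 0 := by
  apply PowerSeries.constantCoeff_subst_eq_zero hw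
  rw [← coeff_zero_eq_constantCoeff_apply, QDer, coeff_iterate_euler]
  simp [Q]

lemma one_sub_mul_inv (w : PowerSeries QRing) (hw : constantCoeff w = 0) :
    (1 - QDerAt w 1) * PowerSeries.invOfUnit (1 - QDerAt w 1) 1 = 1 :=
  PowerSeries.mul_invOfUnit _ _ (by simp [constantCoeff_QDerAt w hw])

lemma constantCoeff_bracket (w : PowerSeries QRing) (hw : constantCoeff w = 0) {n : ℕ}
    (θ : Nat.Partition n) : constantCoeff (bracket w θ) = 0 := by
  rw [bracket]
  split_ifs with h
  · simp [QPartAt, h]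
  · have h0 : constantCoeff (QPartAt w θ) = 0 := by
      obtain ⟨i, hi⟩ := Multiset.exists_mem_of_ne_zero h
      rw [QPartAt, map_multiset_prod]
      apply Multiset.prod_eq_zero
      rw [Multiset.mem_map]
      exact ⟨_, Multiset.mem_map_of_mem _ hi, constantCoeff_QDerAt w hw _⟩
    simp [h0]

end OnePartHurwitz

end

/-!
The proof has three independent ingredients.

*One-part double Hurwitz numbers.* Put `D(σ) = det (1 - X P_σ)`, where `P_σ` is the permutation
matrix; by `permDet_eq_parts` it is the product of the `1 - X ^ m` over the cycle lengths `m` of `σ`.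
The matrix of a transposition is `1 - w wᵀ` with `w = e_a - e_b`, so the matrix determinant lemma and
Jacobi's formula show that summation over `τ ↦ τ σ`, for all transpositions `τ`, acts on
`S(σ) = D(σ) / (1 - X)` as the differential operator `L = d ((d - 1) / 2 - X d/dX)`
(`sum_hookPoly_mul`). This is the cut-and-join equation restricted to hook characters. As the value
`S(σ)(1)` is `d` for a `d`-cycle and `0` otherwise, the number of sequences of `r` transpositions that
turn `σ` into a `d`-cycle is `(L ^ r S(σ))(1) / d` (`card_completions`). The monomials `X ^ k` are
eigenvectors of `L`, so this number is a coefficient of `e^{(d-1)t/2} S(σ)(e^{-t})`, which is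
a quotient of products of hyperbolic sines. The outcome is `doubleHurwitz_div`: the coefficient of `x ^ d q_β` in the
genus `g` series is `d ^ (2g - 2 + l(β)) / |Aut β|` times the coefficient of `t ^ 2g` in
`(t/2)/sinh(t/2) ∏ᵢ sinh(βᵢ t/2)/(βᵢ t/2)`.

*Exchange of variables.* Write `V(t²) = (2/t) sinh(t/2)`. The sum over `β ⊢ d` of these coefficients
comes, through the exponential formula, from the coefficient of `t ^ d Y ^ j` in
`exp (d ∑ₙ qₙ V(n² Y) tⁿ)`. Since `∑ₙ qₙ n ^ (2i) tⁿ = Q^{(2i)}`, collecting powers of `Y` instead gives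
the coefficient of `t ^ d` in `exp (d Q)` times a sum over `θ ⊢ j` of products of the `v_{2i} d Q^{(2i)}`
(`coeff_expSum_comm`, `coeff_expSum_biCoeff`).

*Lagrange inversion.* With `φ = exp Q`, the solution `w` is the compositional inverse of `t / φ(t)`, and
the coefficient of `x ^ d` in `G(w) / (1 - Q^{(1)}(w))` is that of `t ^ d` in `G φ ^ d`
(`coeff_subst_mul_inv`). This turns the sum over `θ` into the asserted right-hand side.
-/

open PowerSeries

noncomputable section

namespace OnePartHurwitz

/-! ### Determinants of rank one perturbations and derivatives of determinants -/

/-- The matrix determinant lemma in its adjugate form, which needs no inverse of `A`. -/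
theorem det_add_vecMulVec {n R : Type*} [Fintype n] [DecidableEq n] [CommRing R] [IsDomain R]
    (A : Matrix n n R) (hA : A.det ≠ 0) (u v : n → R) :
    (A + Matrix.vecMulVec u v).det = A.det + v ⬝ᵥ A.adjugate.mulVec u := by
  apply FaithfulSMul.algebraMap_injective R (FractionRing R)
  set f := algebraMap R (FractionRing R) with hf
  have hu : IsUnit (f.mapMatrix A).det := by
    rw [← RingHom.map_det, isUnit_iff_ne_zero]
    simpa [hf] using hA
  have h := Matrix.det_add_replicateCol_mul_replicateRow (ι := Unit) hu (f ∘ u) (f ∘ v)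
  rw [RingHom.map_det, map_add, map_add, RingHom.map_det]
  have e : f.mapMatrix (Matrix.vecMulVec u v) =
      Matrix.replicateCol Unit (f ∘ u) * Matrix.replicateRow Unit (f ∘ v) := by
    ext i j
    simp [Matrix.vecMulVec_apply, Matrix.mul_apply]
  have e2 : f (v ⬝ᵥ A.adjugate.mulVec u) =
      (f ∘ v) ⬝ᵥ (f.mapMatrix A).adjugate.mulVec (f ∘ u) := by
    rw [← RingHom.map_adjugate]
    simp [dotProduct, Matrix.mulVec, map_sum]
  rw [e, h, e2, Matrix.det_unique (n := Unit), Matrix.add_apply, Matrix.one_apply_eq, mul_add,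
    mul_one]
  congr 1
  rw [Matrix.inv_def]
  simp only [Matrix.mul_apply, Matrix.replicateRow_apply, Matrix.replicateCol_apply,
    Matrix.smul_apply, smul_eq_mul, dotProduct, Matrix.mulVec]
  simp only [Finset.sum_mul, Finset.mul_sum]
  rw [Finset.sum_comm]
  refine Finset.sum_congr rfl fun i _ => Finset.sum_congr rfl fun j _ => ?_
  have := Ring.mul_inverse_cancel _ hu
  linear_combination ((f ∘ v) i * (f.mapMatrix A).adjugate i j * (f ∘ u) j) * this

/-- Jacobi's formula. -/
theorem derivative_det {n R : Type*} [Fintype n] [DecidableEq n] [CommRing R]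
    (A : Matrix n n (Polynomial R)) :
    Polynomial.derivative A.det = (A.adjugate * A.map Polynomial.derivative).trace := by
  have h : ∀ i, (A.adjugate * A.map Polynomial.derivative) i i =
      ∑ ρ : Equiv.Perm n, Equiv.Perm.sign ρ •
        ((∏ j ∈ Finset.univ.erase i, A (ρ j) j) * Polynomial.derivative (A (ρ i) i)) := by
    intro i
    have : (A.adjugate * A.map Polynomial.derivative) i i =
        (A.updateCol i fun k => Polynomial.derivative (A k i)).det := by
      rw [← Matrix.cramer_apply, Matrix.cramer_eq_adjugate_mulVec]
      rfl
    rw [this, Matrix.det_apply]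
    refine Finset.sum_congr rfl fun ρ _ => ?_
    rw [← Finset.prod_erase_mul _ _ (Finset.mem_univ i), Matrix.updateCol_self]
    congr 2
    refine Finset.prod_congr rfl fun j hj => ?_
    rw [Matrix.updateCol_ne (Finset.ne_of_mem_erase hj)]
  rw [Matrix.trace]
  simp only [Matrix.diag_apply, h]
  rw [Finset.sum_comm, Matrix.det_apply, map_sum]
  refine Finset.sum_congr rfl fun ρ _ => ?_
  rw [← Finset.smul_sum, ← Polynomial.derivative_prod_finset]
  rcases Int.units_eq_one_or (Equiv.Perm.sign ρ) with h | h <;> simp [h]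

/-! ### The reciprocal characteristic polynomial of a permutation -/

/-- The reciprocal characteristic polynomial `det (1 - X P_σ)` of a permutation matrix. Up to signs,
its coefficients are the characters of the exterior powers of the permutation representation. Note
that `σ ↦ P_σ` reverses products with Mathlib's convention for permutation matrices. -/
def permDet {n : Type*} [Fintype n] [DecidableEq n] (σ : Equiv.Perm n) : Polynomial ℚ :=
  (1 - (Polynomial.X : Polynomial ℚ) • σ.permMatrix (Polynomial ℚ)).det

section
variable {n : Type*} [Fintype n] [DecidableEq n]

omit [Fintype n] in
theorem one_sub_smul_permMatrix_apply (σ : Equiv.Perm n) (i j : n) :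
    (1 - (Polynomial.X : Polynomial ℚ) • σ.permMatrix (Polynomial ℚ)) i j =
      (if i = j then 1 else 0) - if σ i = j then Polynomial.X else 0 := by
  simp [Matrix.one_apply, PEquiv.toMatrix_apply, Equiv.toPEquiv_apply, eq_comm]

theorem permDet_one : permDet (1 : Equiv.Perm n) = (1 - Polynomial.X) ^ Fintype.card n := by
  have : (1 : Matrix n n (Polynomial ℚ)) - (Polynomial.X : Polynomial ℚ) • (1 : Matrix n n _) =
      (1 - Polynomial.X : Polynomial ℚ) • (1 : Matrix n n _) := by rw [sub_smul, one_smul]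
  rw [permDet, Matrix.permMatrix_one, this, Matrix.det_smul, Matrix.det_one, mul_one]

/-- For disjoint permutations `(P_σ - 1) (P_τ - 1) = 0`, so that
`(1 - X P_σ) (1 - X P_τ) = (1 - X) (1 - X P_{στ})`. -/
theorem permDet_mul_of_disjoint {σ τ : Equiv.Perm n} (h : σ.Disjoint τ) :
    permDet σ * permDet τ = (1 - Polynomial.X) ^ Fintype.card n * permDet (σ * τ) := by
  have key : τ.permMatrix (Polynomial ℚ) + σ.permMatrix (Polynomial ℚ) =
      1 + (σ * τ).permMatrix (Polynomial ℚ) := by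
    ext1 i j
    rcases h i with hi | hi
    · have hi' : (σ * τ) i = τ i := by
        rcases h (τ i) with h2 | h2
        · simpa using h2
        · have : τ i = i := τ.injective h2
          simp [this, hi]
      simp only [Matrix.add_apply, PEquiv.toMatrix_apply, Equiv.toPEquiv_apply, hi, hi',
        Matrix.one_apply, Option.mem_some_iff]
      rw [add_comm]
    · have hi' : (σ * τ) i = σ i := by simp [hi]
      simp only [Matrix.add_apply, PEquiv.toMatrix_apply, Equiv.toPEquiv_apply, hi, hi',
        Matrix.one_apply, Option.mem_some_iff]
  have h1 := permDet_one (n := n)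
  rw [permDet, Matrix.permMatrix_one] at h1
  rw [mul_comm, ← h1, permDet, permDet, permDet, ← Matrix.det_mul, ← Matrix.det_mul]
  congr 1
  simp only [Matrix.permMatrix_mul] at key ⊢
  simp only [sub_mul, mul_sub, one_mul, mul_one, smul_mul_assoc, mul_smul_comm]
  rw [smul_sub, smul_sub]
  have : (Polynomial.X : Polynomial ℚ) • σ.permMatrix (Polynomial ℚ) +
      (Polynomial.X : Polynomial ℚ) • τ.permMatrix (Polynomial ℚ) =
      (Polynomial.X : Polynomial ℚ) • 1 + (Polynomial.X : Polynomial ℚ) •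
        (τ.permMatrix (Polynomial ℚ) * σ.permMatrix (Polynomial ℚ)) := by
    rw [← smul_add, ← smul_add, ← key, add_comm]
  rw [← sub_eq_zero, ← neg_eq_zero, ← sub_eq_zero.2 this]
  abel

/-- The only permutations that contribute to the Leibniz expansion of `det (1 - X P_c)`, for a
cycle `c`, are `1` and `c`. -/
theorem eq_one_or_eq_of_isCycle {c ρ : Equiv.Perm n} (hc : c.IsCycle)
    (h : ∀ i, ρ i = i ∨ ρ i = c i) : ρ = 1 ∨ ρ = c := by
  by_cases h1 : ρ = 1
  · exact Or.inl h1
  right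
  obtain ⟨i, hi⟩ : ∃ i, ρ i ≠ i := by
    by_contra hne
    push Not at hne
    exact h1 (Equiv.ext hne)
  have hci : c i ≠ i := by
    rcases h i with h2 | h2
    · exact absurd h2 hi
    · rwa [← h2]
  have hk : ∀ k : ℕ, ρ ((c ^ k) i) = c ((c ^ k) i) := by
    intro k
    induction k with
    | zero => simpa using (h i).resolve_left hi
    | succ k ih =>
      refine (h _).resolve_left fun h2 => ?_
      rw [pow_succ', Equiv.Perm.mul_apply, ← ih] at h2
      have h3 := ρ.injective h2
      rw [ih, ← Equiv.Perm.mul_apply, ← pow_succ', pow_succ, Equiv.Perm.mul_apply] at h3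
      exact hci ((c ^ k).injective h3)
  ext j
  by_cases hj : c j = j
  · rcases h j with h2 | h2 <;> simp [h2, hj]
  · obtain ⟨k, rfl⟩ := hc.exists_pow_eq hci hj
    exact hk k

theorem permDet_of_isCycle {c : Equiv.Perm n} (hc : c.IsCycle) :
    permDet c = (1 - Polynomial.X) ^ (Fintype.card n - c.support.card) *
      (1 - Polynomial.X ^ c.support.card) := by
  have hne : (1 : Equiv.Perm n) ≠ c := fun h => hc.ne_one h.symm
  rw [permDet, ← Matrix.det_transpose, Matrix.det_apply,
    ← Finset.sum_subset (Finset.subset_univ {1, c}), Finset.sum_pair hne]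
  · simp only [Matrix.transpose_apply, one_sub_smul_permMatrix_apply, Equiv.Perm.sign_one,
      Equiv.Perm.one_apply, one_smul, if_true]
    have e : ∀ f : n → Polynomial ℚ, ∏ i, f i =
        (∏ i ∈ c.support, f i) * ∏ i ∈ c.supportᶜ, f i :=
      fun f => (Finset.prod_mul_prod_compl _ _).symm
    have e1 : ∏ x, ((1 : Polynomial ℚ) - if c x = x then Polynomial.X else 0) =
        (1 - Polynomial.X) ^ (Fintype.card n - c.support.card) := by
      rw [e, Finset.prod_eq_one, one_mul, Finset.prod_congr rfl, Finset.prod_const,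
        Finset.card_compl]
      · intro i hi
        rw [Finset.mem_compl, Equiv.Perm.mem_support, not_not] at hi
        rw [if_pos hi]
      · intro i hi
        rw [Equiv.Perm.mem_support] at hi
        rw [if_neg hi, sub_zero]
    have e2 : ∏ x, ((if x = c x then (1 : Polynomial ℚ) else 0) - Polynomial.X) =
        (-Polynomial.X) ^ c.support.card *
          (1 - Polynomial.X) ^ (Fintype.card n - c.support.card) := by
      rw [e, ← Finset.card_compl]
      congr 1
      · refine Finset.prod_eq_pow_card fun i hi => ?_
        rw [Equiv.Perm.mem_support] at hi
        rw [if_neg hi.symm, zero_sub]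
      · refine Finset.prod_eq_pow_card fun i hi => ?_
        rw [Finset.mem_compl, Equiv.Perm.mem_support, not_not] at hi
        rw [if_pos hi.symm]
    rw [e1, e2, hc.sign]
    rcases Nat.even_or_odd c.support.card with h | h
    · simp [h.neg_one_pow, h.neg_pow]
      ring
    · simp [h.neg_one_pow, h.neg_pow]
      ring
  · intro ρ _ hρ
    simp only [Finset.mem_insert, Finset.mem_singleton, not_or] at hρ
    have : ∃ i, ρ i ≠ i ∧ ρ i ≠ c i := by
      by_contra h
      push Not at h
      have := eq_one_or_eq_of_isCycle hc (ρ := ρ) fun i => by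
        by_cases h2 : ρ i = i
        · exact Or.inl h2
        · exact Or.inr (h i h2)
      tauto
    obtain ⟨i, h1, h2⟩ := this
    rw [Finset.prod_eq_zero (Finset.mem_univ i), smul_zero]
    rw [Matrix.transpose_apply, one_sub_smul_permMatrix_apply, if_neg h1.symm, if_neg h2.symm,
      sub_zero]

theorem one_sub_X_ne_zero : (1 - Polynomial.X : Polynomial ℚ) ≠ 0 := by
  intro h
  have := congrArg (Polynomial.eval 0) h
  simp at this

theorem permDet_eq_cycleType (σ : Equiv.Perm n) :
    permDet σ = (1 - Polynomial.X) ^ (Fintype.card n - σ.support.card) *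
      (σ.cycleType.map fun m => 1 - Polynomial.X ^ m).prod := by
  induction σ using Equiv.Perm.cycle_induction_on with
  | base_one => simp [permDet_one]
  | base_cycles σ hσ => simp [permDet_of_isCycle hσ, hσ.cycleType]
  | induction_disjoint σ τ hd _ hσ hτ =>
    have h := permDet_mul_of_disjoint hd
    apply mul_left_cancel₀ (pow_ne_zero (Fintype.card n) one_sub_X_ne_zero)
    rw [← h, hσ, hτ, hd.cycleType_mul, Multiset.map_add, Multiset.prod_add, hd.card_support_mul]
    have hle := (σ * τ).support.card_le_univ
    rw [hd.card_support_mul] at hle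
    have e : (Fintype.card n - σ.support.card) + (Fintype.card n - τ.support.card) =
        Fintype.card n + (Fintype.card n - (σ.support.card + τ.support.card)) := by omega
    have := congrArg (fun k => (1 - Polynomial.X : Polynomial ℚ) ^ k) e
    simp only [pow_add] at this
    linear_combination (σ.cycleType.map fun m => (1 : Polynomial ℚ) - Polynomial.X ^ m).prod *
      (τ.cycleType.map fun m => (1 : Polynomial ℚ) - Polynomial.X ^ m).prod * this

/-- `det (1 - X P_σ) = ∏ (1 - X ^ m)`, over the lengths `m` of all cycles of `σ`, the fixed points
included. -/
theorem permDet_eq_parts (σ : Equiv.Perm n) :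
    permDet σ = (σ.partition.parts.map fun m => 1 - Polynomial.X ^ m).prod := by
  rw [permDet_eq_cycleType, Equiv.Perm.parts_partition, Multiset.map_add, Multiset.prod_add]
  simp [mul_comm]

end

/-! ### Left multiplication by all transpositions -/

section
variable {n : Type*} [Fintype n] [DecidableEq n]

theorem card_filter_swap_eq {τ : Equiv.Perm n} (hτ : τ.IsSwap) :
    (Finset.univ.filter fun p : n × n => p.1 ≠ p.2 ∧ Equiv.swap p.1 p.2 = τ).card = 2 := by
  obtain ⟨x, y, hxy, rfl⟩ := hτ
  have : (Finset.univ.filter fun p : n × n => p.1 ≠ p.2 ∧ Equiv.swap p.1 p.2 = Equiv.swap x y) =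
      {(x, y), (y, x)} := by
    ext ⟨a, b⟩
    simp only [Finset.mem_filter, Finset.mem_univ, true_and, Finset.mem_insert,
      Finset.mem_singleton, Prod.mk.injEq]
    constructor
    · rintro ⟨hab, h⟩
      have hx : Equiv.swap a b x = y := by rw [h, Equiv.swap_apply_left]
      have hy : Equiv.swap a b y = x := by rw [h, Equiv.swap_apply_right]
      rw [Equiv.swap_apply_def] at hx hy
      grind
    · rintro (⟨rfl, rfl⟩ | ⟨rfl, rfl⟩)
      · exact ⟨hxy, rfl⟩
      · exact ⟨hxy.symm, Equiv.swap_comm _ _⟩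
  rw [this, Finset.card_pair]
  simp [hxy]

open Classical in
/-- Every transposition is `swap a b` for two ordered pairs `(a, b)`; the diagonal pairs give `1`. -/
theorem sum_swap {M : Type*} [AddCommMonoid M] (f : Equiv.Perm n → M) :
    ∑ a, ∑ b, f (Equiv.swap a b) =
      Fintype.card n • f 1 + 2 • ∑ τ with τ.IsSwap, f τ := by
  rw [← Fintype.sum_prod_type' (f := fun a b => f (Equiv.swap a b)),
    ← Finset.sum_filter_add_sum_filter_not _ (fun p : n × n => p.1 = p.2)]
  congr 1
  · have : (Finset.univ.filter fun p : n × n => p.1 = p.2) = Finset.univ.diag := by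
      ext ⟨a, b⟩
      simp
    rw [this, Finset.sum_diag]
    simp [Equiv.Perm.one_def]
  · rw [← Finset.sum_fiberwise_of_maps_to (t := Finset.univ.filter fun τ : Equiv.Perm n => τ.IsSwap)
      (g := fun p : n × n => Equiv.swap p.1 p.2), Finset.smul_sum]
    · refine Finset.sum_congr rfl fun τ hτ => ?_
      rw [Finset.mem_filter] at hτ
      rw [← card_filter_swap_eq hτ.2, Finset.filter_filter, ← Finset.sum_const]
      refine Finset.sum_congr (by congr) fun p hp => ?_
      rw [Finset.mem_filter] at hp
      rw [hp.2.2]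
    · intro p hp
      rw [Finset.mem_filter] at hp ⊢
      exact ⟨Finset.mem_univ _, p.1, p.2, hp.2, rfl⟩

theorem eval_zero_permDet (σ : Equiv.Perm n) : (permDet σ).eval 0 = 1 := by
  rw [permDet_eq_parts, Polynomial.eval_multiset_prod, Multiset.map_map]
  apply Multiset.prod_eq_one
  intro x hx
  obtain ⟨m, hm, rfl⟩ := Multiset.mem_map.1 hx
  have := σ.partition.parts_pos hm
  simp [this.ne']

theorem permDet_ne_zero (σ : Equiv.Perm n) : permDet σ ≠ 0 := by
  intro h
  simpa [h] using eval_zero_permDet σ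

/-- The matrix `adj (1 - X P_σ) P_σ`. -/
def adjPerm (σ : Equiv.Perm n) : Matrix n n (Polynomial ℚ) :=
  (1 - (Polynomial.X : Polynomial ℚ) • σ.permMatrix (Polynomial ℚ)).adjugate *
    σ.permMatrix (Polynomial ℚ)

omit [Fintype n] in
theorem permMatrix_swap (a b : n) :
    (Equiv.swap a b).permMatrix (Polynomial ℚ) =
      1 - Matrix.vecMulVec (Pi.single a 1 - Pi.single b 1) (Pi.single a 1 - Pi.single b 1) := by
  ext1 i j
  simp only [PEquiv.toMatrix_apply, Equiv.toPEquiv_apply, Option.mem_some_iff, Matrix.sub_apply,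
    Matrix.one_apply, Matrix.vecMulVec_apply, Pi.sub_apply, Pi.single_apply, Equiv.swap_apply_def]
  grind

/-- `P_{(a b)} = 1 - w wᵀ` with `w = e_a - e_b`, so a transposition perturbs `1 - X P_σ` by a matrix
of rank one. -/
theorem permDet_swap_mul (a b : n) (σ : Equiv.Perm n) :
    permDet (Equiv.swap a b * σ) = permDet σ + Polynomial.X *
      (adjPerm σ a a + adjPerm σ b b - adjPerm σ a b - adjPerm σ b a) := by
  set w : n → Polynomial ℚ := Pi.single a 1 - Pi.single b 1 with hw
  have e : (1 - (Polynomial.X : Polynomial ℚ) •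
      (Equiv.swap a b * σ).permMatrix (Polynomial ℚ)) =
      (1 - (Polynomial.X : Polynomial ℚ) • σ.permMatrix (Polynomial ℚ)) +
      Matrix.vecMulVec ((Polynomial.X : Polynomial ℚ) • (σ.permMatrix (Polynomial ℚ)).mulVec w)
        w := by
    rw [Matrix.permMatrix_mul, permMatrix_swap, ← hw, mul_sub, mul_one, smul_sub,
      Matrix.smul_vecMulVec, Matrix.mul_vecMulVec]
    abel
  rw [permDet, e, det_add_vecMulVec _ (permDet_ne_zero σ), permDet, Matrix.mulVec_smul,
    Matrix.mulVec_mulVec, dotProduct_smul, smul_eq_mul]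
  congr 2
  change w ⬝ᵥ (adjPerm σ).mulVec w = _
  simp only [hw, Matrix.mulVec_sub, sub_dotProduct, dotProduct_sub, Matrix.mulVec_single_one,
    single_one_dotProduct, Matrix.col_apply]
  ring

theorem trace_adjPerm (σ : Equiv.Perm n) :
    (adjPerm σ).trace = -Polynomial.derivative (permDet σ) := by
  rw [permDet, derivative_det, adjPerm, ← Matrix.trace_neg, ← mul_neg]
  congr 2
  ext1 i j
  rw [Matrix.neg_apply, Matrix.map_apply, one_sub_smul_permMatrix_apply]
  simp only [PEquiv.toMatrix_apply, Equiv.toPEquiv_apply, Option.mem_some_iff]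
  split_ifs <;> simp

theorem one_sub_X_mul_sum_adjPerm (σ : Equiv.Perm n) :
    (1 - Polynomial.X) * ∑ a, ∑ b, adjPerm σ a b =
      (Fintype.card n : Polynomial ℚ) * permDet σ := by
  set M := (1 - (Polynomial.X : Polynomial ℚ) • σ.permMatrix (Polynomial ℚ)) with hM
  have hP : (σ.permMatrix (Polynomial ℚ)).mulVec 1 = 1 := by
    rw [Matrix.permMatrix_mulVec]
    rfl
  have h1 : M.mulVec 1 = (1 - Polynomial.X : Polynomial ℚ) • (1 : n → Polynomial ℚ) := by
    rw [hM, Matrix.sub_mulVec, Matrix.one_mulVec, Matrix.smul_mulVec, hP, sub_smul, one_smul]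
  have h2 : (1 - Polynomial.X : Polynomial ℚ) • (adjPerm σ).mulVec 1 =
      permDet σ • (1 : n → Polynomial ℚ) := by
    rw [adjPerm, ← Matrix.mulVec_mulVec, hP, ← Matrix.mulVec_smul, ← h1, Matrix.mulVec_mulVec,
      Matrix.adjugate_mul, Matrix.smul_mulVec, Matrix.one_mulVec]
    rfl
  have h3 := congrArg (fun v => ∑ i, v i) h2
  simp only [Pi.smul_apply, Pi.one_apply, smul_eq_mul, mul_one, Finset.sum_const,
    Finset.card_univ, nsmul_eq_mul, Matrix.mulVec, dotProduct] at h3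
  rw [← h3, Finset.mul_sum]

open Classical in
/-- The action of the sum of all transpositions on `σ ↦ det (1 - X P_σ)`: a first order differential
operator in `X`. It comes from `∑ w wᵀ = d - J`, where `J` is the all-ones matrix, from Jacobi's
formula and from the eigenvector `P_σ 1 = 1`. -/
theorem sum_permDet_mul (σ : Equiv.Perm n) :
    (1 - Polynomial.X) * (2 * ∑ τ : Equiv.Perm n with τ.IsSwap, permDet (τ * σ)) =
      (Fintype.card n : Polynomial ℚ) * (((Fintype.card n : Polynomial ℚ) - 1) *
        (1 - Polynomial.X) * permDet σ -
        2 * Polynomial.X * permDet σ -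
        2 * (1 - Polynomial.X) * Polynomial.X * Polynomial.derivative (permDet σ)) := by
  have h := sum_swap (n := n) fun τ => permDet (τ * σ)
  simp only [one_mul, nsmul_eq_mul, permDet_swap_mul, Nat.cast_ofNat] at h
  have h1 : ∑ a : n, ∑ b : n, (permDet σ + Polynomial.X *
      (adjPerm σ a a + adjPerm σ b b - adjPerm σ a b - adjPerm σ b a)) =
      (Fintype.card n : Polynomial ℚ) ^ 2 * permDet σ + Polynomial.X *
        (2 * ((Fintype.card n : Polynomial ℚ) * (adjPerm σ).trace) - 2 * ∑ a, ∑ b, adjPerm σ a b) := by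
    have h2 : ∑ a, ∑ b, adjPerm σ b a = ∑ a, ∑ b, adjPerm σ a b := Finset.sum_comm
    simp only [Finset.sum_add_distrib, Finset.sum_sub_distrib, ← Finset.mul_sum, h2,
      Finset.sum_const, Finset.card_univ, nsmul_eq_mul, Matrix.trace, Matrix.diag_apply]
    ring
  rw [h1, trace_adjPerm] at h
  have h3 := one_sub_X_mul_sum_adjPerm σ
  linear_combination -(1 - Polynomial.X) * h - 2 * Polynomial.X * h3

end

/-! ### Counting factorizations of long cycles -/

/-- `∏ₘ (1 - X ^ m) / (1 - X)`, the product being over the members `m` of a nonempty multiset. At the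
cycle lengths of a permutation, the coefficients are up to sign the hook characters of the symmetric
group. -/
def hookPoly (s : Multiset ℕ) : Polynomial ℚ :=
  (1 - Polynomial.X) ^ (s.card - 1) *
    (s.map fun m => ∑ i ∈ Finset.range m, (Polynomial.X : Polynomial ℚ) ^ i).prod

theorem one_sub_X_mul_hookPoly {s : Multiset ℕ} (hs : s ≠ 0) :
    (1 - Polynomial.X) * hookPoly s =
      (s.map fun m : ℕ => 1 - (Polynomial.X : Polynomial ℚ) ^ m).prod := by
  have hc : s.card = s.card - 1 + 1 := by
    have := Multiset.card_pos.2 hs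
    omega
  rw [hookPoly, ← mul_assoc, ← pow_succ', ← hc]
  simp only [← mul_neg_geom_sum]
  rw [Multiset.prod_map_mul, Multiset.map_const', Multiset.prod_replicate]

/-- The value at `1` detects the multisets with one member. -/
theorem eval_one_hookPoly {s : Multiset ℕ} (hs : s ≠ 0) :
    (hookPoly s).eval 1 = if s = {s.sum} then (s.sum : ℚ) else 0 := by
  rw [hookPoly, Polynomial.eval_mul, Polynomial.eval_pow]
  split_ifs with h
  · rw [h]
    simp [Polynomial.eval_finsetSum]
  · have hc : s.card - 1 ≠ 0 := by
      have := Multiset.card_pos.2 hs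
      intro h0
      have h1 : s.card = 1 := by omega
      obtain ⟨a, rfl⟩ := Multiset.card_eq_one.1 h1
      exact h (by simp)
    simp [hc]

/-- The operator `(d - 1) / 2 - X d/dX` on polynomials; `X ^ k` is an eigenvector. -/
def contentOp (d : ℕ) : Module.End ℚ (Polynomial ℚ) :=
  (((d : ℚ) - 1) / 2) • LinearMap.id -
    LinearMap.mulLeft ℚ (Polynomial.X : Polynomial ℚ) ∘ₗ Polynomial.derivative

theorem contentOp_apply (d : ℕ) (f : Polynomial ℚ) :
    contentOp d f = (((d : ℚ) - 1) / 2) • f - Polynomial.X * Polynomial.derivative f := by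
  simp [contentOp]

theorem contentOp_pow_X_pow (d r k : ℕ) :
    (contentOp d ^ r) (Polynomial.X ^ k) =
      (((d : ℚ) - 1) / 2 - k) ^ r • (Polynomial.X ^ k : Polynomial ℚ) := by
  induction r with
  | zero => simp
  | succ r ih =>
    rw [pow_succ', Module.End.mul_apply, ih, map_smul, contentOp_apply, Polynomial.derivative_X_pow,
      pow_succ, mul_smul, sub_smul]
    congr 2
    rcases k with _ | k
    · simp
    · simp only [Nat.add_sub_cancel, Polynomial.smul_eq_C_mul]
      push_cast
      rw [pow_succ]
      simp
      ring

/-- `e^{(d-1)t/2} f(e^{-t})`, the exponential generating function of the values at `1` of the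
iterates of `contentOp d` on `f`. -/
def expEval (d : ℕ) (f : Polynomial ℚ) : PowerSeries ℚ :=
  rescale (((d : ℚ) - 1) / 2) (exp ℚ) * Polynomial.aeval (rescale (-1 : ℚ) (exp ℚ)) f

theorem rescale_exp_pow (c : ℚ) (k : ℕ) :
    rescale c (exp ℚ) ^ k = rescale (k * c) (exp ℚ) := by
  rw [← map_pow, exp_pow_eq_rescale_exp, rescale_rescale]

theorem eval_one_contentOp_pow (d r : ℕ) (f : Polynomial ℚ) :
    ((contentOp d ^ r) f).eval 1 = r.factorial * coeff r (expEval d f) := by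
  -- Both sides are linear in `f`, and a monomial is an eigenvector of `contentOp d`.
  induction f using Polynomial.induction_on' with
  | add p q hp hq =>
    rw [map_add, Polynomial.eval_add, hp, hq, expEval, expEval, expEval, map_add, mul_add,
      map_add, mul_add]
  | monomial k a =>
    rw [← mul_one a, ← smul_eq_mul, ← Polynomial.smul_monomial, map_smul,
      Polynomial.monomial_one_right_eq_X_pow,
      contentOp_pow_X_pow, expEval, map_smul, map_pow, Polynomial.aeval_X, rescale_exp_pow,
      mul_smul_comm, exp_mul_exp_eq_exp_add, map_smul, coeff_rescale, coeff_exp]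
    have : (r.factorial : ℚ) ≠ 0 := by positivity
    simp
    field_simp
    ring

/-- `e^{mt/2} (1 - e^{-mt}) = 2 sinh(mt/2)`. -/
theorem X_mul_sinhQuot_rescale (m : ℕ) :
    rescale (m / 2 : ℚ) (exp ℚ) * (1 - rescale (-1 : ℚ) (exp ℚ) ^ m) =
      X * (C (m : ℚ) * rescale (m : ℚ) sinhQuot) := by
  have h := congrArg (rescale (m : ℚ)) X_mul_sinhQuot
  rw [map_mul, map_sub, rescale_rescale, rescale_rescale, rescale_X] at h
  rw [← mul_assoc, mul_comm X, h, rescale_exp_pow, mul_sub, mul_one, exp_mul_exp_eq_exp_add]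
  congr 3 <;> ring

theorem sinhQuot_mul_expEval_hookPoly {s : Multiset ℕ} (hs : s ≠ 0) :
    sinhQuot * expEval s.sum (hookPoly s) =
      X ^ (s.card - 1) * (C ((s.prod : ℕ) : ℚ) *
        (s.map fun m : ℕ => rescale (m : ℚ) sinhQuot).prod) := by
  have hc : s.card = s.card - 1 + 1 := by
    have := Multiset.card_pos.2 hs
    omega
  have key : ∀ s : Multiset ℕ, rescale ((s.sum : ℚ) / 2) (exp ℚ) *
      (s.map fun m : ℕ => 1 - rescale (-1 : ℚ) (exp ℚ) ^ m).prod =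
      X ^ s.card * (C ((s.prod : ℕ) : ℚ) * (s.map fun m : ℕ => rescale (m : ℚ) sinhQuot).prod) := by
    intro s
    induction s using Multiset.induction with
    | empty => simp
    | cons m s ih =>
      have h := X_mul_sinhQuot_rescale m
      have e : (((m ::ₘ s).sum : ℕ) : ℚ) / 2 = m / 2 + s.sum / 2 := by
        rw [Multiset.sum_cons]
        push_cast
        ring
      rw [e, ← exp_mul_exp_eq_exp_add, Multiset.map_cons, Multiset.prod_cons, Multiset.map_cons,
        Multiset.prod_cons, Multiset.prod_cons, Multiset.card_cons]
      rw [Nat.cast_mul, map_mul, pow_succ]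
      linear_combination (rescale ((s.sum : ℚ) / 2) (exp ℚ) *
        (s.map fun m : ℕ => 1 - rescale (-1 : ℚ) (exp ℚ) ^ m).prod) * h +
        (X * (C (m : ℚ) * rescale (m : ℚ) sinhQuot)) * ih
  apply mul_left_cancel₀ (X_ne_zero : (X : PowerSeries ℚ) ≠ 0)
  rw [← mul_assoc X (X ^ _), ← pow_succ', ← hc, ← key s, ← mul_assoc]
  have h1 := X_mul_sinhQuot_rescale 1
  simp only [Nat.cast_one, map_one, one_mul, rescale_one, RingHom.id_apply, pow_one] at h1
  have h2 := congrArg (Polynomial.aeval (rescale (-1 : ℚ) (exp ℚ))) (one_sub_X_mul_hookPoly hs)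
  rw [map_mul, map_multiset_prod, Multiset.map_map] at h2
  simp only [map_sub, map_one, Polynomial.aeval_X, Function.comp_def, map_pow] at h2
  rw [← h2, ← h1, expEval]
  have e : ((s.sum : ℕ) : ℚ) / 2 = 1 / 2 + (s.sum - 1) / 2 := by ring
  rw [e, ← exp_mul_exp_eq_exp_add]
  ring

section
variable {n : Type*} [Fintype n] [DecidableEq n]

theorem parts_partition_ne_zero [Nonempty n] (σ : Equiv.Perm n) : σ.partition.parts ≠ 0 := by
  intro h
  have := σ.partition.parts_sum
  rw [h] at this
  exact Fintype.card_ne_zero this.symm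

open Classical in
/-- Summing over one transposition applies `d * contentOp d`: the two factors `1 - X` that clear the
denominators of `sum_permDet_mul` cancel. -/
theorem sum_hookPoly_mul [Nonempty n] (σ : Equiv.Perm n) :
    ∑ τ : {τ : Equiv.Perm n // τ.IsSwap}, hookPoly ((τ : Equiv.Perm n) * σ).partition.parts =
      (Fintype.card n : ℚ) • contentOp (Fintype.card n) (hookPoly σ.partition.parts) := by
  have e : ∀ σ : Equiv.Perm n, permDet σ = (1 - Polynomial.X) * hookPoly σ.partition.parts :=
    fun σ => by rw [one_sub_X_mul_hookPoly (parts_partition_ne_zero σ), permDet_eq_parts]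
  have h := sum_permDet_mul σ
  rw [Finset.sum_subtype (p := fun τ : Equiv.Perm n => τ.IsSwap) _ (by simp)] at h
  simp only [e, ← Finset.mul_sum, Polynomial.derivative_mul, Polynomial.derivative_sub,
    Polynomial.derivative_one, Polynomial.derivative_X] at h
  apply mul_left_cancel₀ (pow_ne_zero 2 one_sub_X_ne_zero)
  apply mul_left_cancel₀ (two_ne_zero : (2 : Polynomial ℚ) ≠ 0)
  have h2 : (2 : Polynomial ℚ) * Polynomial.C (((Fintype.card n : ℚ) - 1) / 2) =
      (Fintype.card n : Polynomial ℚ) - 1 := by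
    rw [← Polynomial.C_ofNat, ← Polynomial.C_mul, mul_div_cancel₀ _ (two_ne_zero)]
    simp
  rw [contentOp_apply, Polynomial.smul_eq_C_mul, Polynomial.smul_eq_C_mul, map_natCast]
  linear_combination h - (1 - Polynomial.X) ^ 2 * (Fintype.card n : Polynomial ℚ) *
    hookPoly σ.partition.parts * h2

open Classical in
theorem sum_hookPoly_tuple [Nonempty n] (r : ℕ) (σ : Equiv.Perm n) :
    ∑ τ : Fin r → {τ : Equiv.Perm n // τ.IsSwap},
      hookPoly ((List.ofFn fun i => (τ i : Equiv.Perm n)).reverse.prod * σ).partition.parts =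
      (Fintype.card n : ℚ) ^ r •
        (contentOp (Fintype.card n) ^ r) (hookPoly σ.partition.parts) := by
  induction r generalizing σ with
  | zero => simp
  | succ r ih =>
    rw [← (Fin.consEquiv fun _ : Fin (r + 1) => {τ : Equiv.Perm n // τ.IsSwap}).sum_comp,
      Fintype.sum_prod_type]
    simp only [Fin.consEquiv_apply, List.ofFn_succ, Fin.cons_zero, Fin.cons_succ,
      List.reverse_cons, List.prod_append, List.prod_singleton, mul_assoc, ih]
    rw [← Finset.smul_sum, ← map_sum, sum_hookPoly_mul, map_smul, smul_smul, ← pow_succ,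
      pow_succ (contentOp _), Module.End.mul_apply]

open Classical in
/-- The number of ways to complete `σ` by `r` transpositions to a long cycle. -/
theorem card_completions [Nonempty n] (r : ℕ) (σ : Equiv.Perm n) :
    (Fintype.card n : ℚ) * (Finset.univ.filter
      fun τ : Fin r → {τ : Equiv.Perm n // τ.IsSwap} =>
        ((List.ofFn fun i => (τ i : Equiv.Perm n)).reverse.prod * σ).partition.parts =
          {Fintype.card n}).card =
      (Fintype.card n : ℚ) ^ r *
        (r.factorial * coeff r (expEval (Fintype.card n) (hookPoly σ.partition.parts))) := by
  have h := congrArg (Polynomial.eval 1) (sum_hookPoly_tuple r σ)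
  rw [Polynomial.eval_smul, eval_one_contentOp_pow, Polynomial.eval_finsetSum, smul_eq_mul] at h
  rw [← h]
  simp only [eval_one_hookPoly (parts_partition_ne_zero _), Nat.Partition.parts_sum]
  rw [← Finset.sum_filter, Finset.sum_const, nsmul_eq_mul, mul_comm]

end

/-- `[t ^ 2g]` of `(t/2)/sinh(t/2) ∏ₘ sinh(mt/2)/(mt/2)`, where `m` runs through `s`. -/
def sinhCoeff (g : ℕ) (s : Multiset ℕ) : ℚ :=
  coeff (2 * g) (sinhQuot⁻¹ * (s.map fun m : ℕ => rescale (m : ℚ) sinhQuot).prod)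

theorem coeff_expEval_hookPoly (g : ℕ) {s : Multiset ℕ} (hs : s ≠ 0) :
    coeff (2 * g + (s.card - 1)) (expEval s.sum (hookPoly s)) = s.prod * sinhCoeff g s := by
  have h := congrArg (fun f => sinhQuot⁻¹ * f) (sinhQuot_mul_expEval_hookPoly hs)
  rw [← mul_assoc, mul_comm sinhQuot⁻¹, sinhQuot_mul_inv, one_mul] at h
  rw [h, sinhCoeff, mul_left_comm, mul_left_comm sinhQuot⁻¹, coeff_X_pow_mul, coeff_C_mul]

/-! ### The one-part double Hurwitz numbers -/

theorem filter_two_le_add_replicate {d : ℕ} (β : Nat.Partition d) :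
    β.parts.filter (2 ≤ ·) + Multiset.replicate (β.parts.count 1) 1 = β.parts := by
  ext i
  rw [Multiset.count_add, Multiset.count_filter, Multiset.count_replicate]
  rcases i with _ | _ | i
  · have : 0 ∉ β.parts := fun h => (β.parts_pos h).ne' rfl
    simp [this]
  · simp
  · simp

theorem cycleType_eq_filter_iff {d : ℕ} (β : Nat.Partition d) (σ : Equiv.Perm (Fin d)) :
    σ.cycleType = β.parts.filter (2 ≤ ·) ↔ σ.partition.parts = β.parts := by
  refine ⟨fun h => ?_, fun h => by rw [← h, Equiv.Perm.filter_parts_partition_eq_cycleType]⟩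
  have h1 := filter_two_le_add_replicate β
  have h2 := congrArg Multiset.sum h1
  rw [Multiset.sum_add, Multiset.sum_replicate, β.parts_sum, ← h, σ.sum_cycleType, smul_eq_mul,
    mul_one] at h2
  have h3 : Fintype.card (Fin d) - σ.support.card = β.parts.count 1 := by
    rw [Fintype.card_fin]
    omega
  rw [Equiv.Perm.parts_partition, h3, h, h1]

open Classical in
/-- The size of the conjugacy class `C_β` is `d! / (∏ βᵢ |Aut β|)`. -/
theorem card_parts_eq_mul {d : ℕ} (β : Nat.Partition d) :
    (Finset.univ.filter fun σ : Equiv.Perm (Fin d) => σ.partition.parts = β.parts).card *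
      (β.parts.prod * autCard β) = d.factorial := by
  set m := β.parts.filter (2 ≤ ·) with hm
  have h1 : m + Multiset.replicate (β.parts.count 1) 1 = β.parts := filter_two_le_add_replicate β
  have hs := congrArg Multiset.sum h1
  rw [Multiset.sum_add, Multiset.sum_replicate, β.parts_sum, smul_eq_mul, mul_one] at hs
  have hp := congrArg Multiset.prod h1
  rw [Multiset.prod_add, Multiset.prod_replicate, one_pow, mul_one] at hp
  have h := Equiv.Perm.card_of_cycleType_mul_eq (Fin d) m
  rw [if_pos ⟨by rw [Fintype.card_fin]; omega, fun a ha => (Multiset.mem_filter.1 ha).2⟩,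
    Fintype.card_fin, hp] at h
  have h2 : d - m.sum = β.parts.count 1 := by omega
  have ha : autCard β = (β.parts.count 1).factorial * ∏ i ∈ m.toFinset, (m.count i).factorial := by
    have hsub : β.parts.toFinset ⊆ insert 1 m.toFinset := by
      intro i hi
      rw [Multiset.mem_toFinset] at hi
      rw [Finset.mem_insert, Multiset.mem_toFinset, hm, Multiset.mem_filter]
      have := β.parts_pos hi
      by_cases h : i = 1
      · exact Or.inl h
      · exact Or.inr ⟨hi, by omega⟩
    have h1m : 1 ∉ m.toFinset := by simp [hm]
    rw [autCard, Finset.prod_subset hsub, Finset.prod_insert h1m]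
    · congr 1
      refine Finset.prod_congr rfl fun i hi => ?_
      rw [Multiset.mem_toFinset] at hi
      rw [hm, Multiset.count_filter_of_pos (Multiset.mem_filter.1 hi).2]
    · intro i _ hi
      rw [Multiset.mem_toFinset] at hi
      rw [Multiset.count_eq_zero_of_notMem hi, Nat.factorial_zero]
  rw [ha, ← h, h2]
  simp only [hm, cycleType_eq_filter_iff]
  ring

theorem isPretransitive_of_long_cycle {d : ℕ} {G : Subgroup (Equiv.Perm (Fin d))}
    {γ : Equiv.Perm (Fin d)} (hγ : γ ∈ G) (hp : γ.partition.parts = {d}) :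
    MulAction.IsPretransitive G (Fin d) := by
  rcases Nat.lt_or_ge d 2 with hd | hd
  · have : Subsingleton (Fin d) := by
      apply Fin.subsingleton_iff_le_one.2
      omega
    exact ⟨fun x y => ⟨1, Subsingleton.elim _ _⟩⟩
  have hc : γ.cycleType = {d} := by
    rw [← Equiv.Perm.filter_parts_partition_eq_cycleType, hp]
    simp [hd]
  have hcyc : γ.IsCycle := by
    rw [← Equiv.Perm.card_cycleType_eq_one, hc, Multiset.card_singleton]
  have hsupp : γ.support = Finset.univ := by
    apply Finset.eq_univ_of_card
    rw [← Equiv.Perm.sum_cycleType, hc, Multiset.sum_singleton, Fintype.card_fin]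
  refine ⟨fun x y => ?_⟩
  have hx : γ x ≠ x := by rw [← Equiv.Perm.mem_support, hsupp]; exact Finset.mem_univ x
  have hy : γ y ≠ y := by rw [← Equiv.Perm.mem_support, hsupp]; exact Finset.mem_univ y
  obtain ⟨i, hi⟩ := hcyc.exists_zpow_eq hx hy
  exact ⟨⟨γ ^ i, G.zpow_mem hγ i⟩, hi⟩

open Classical in
/-- In the one-part case the transitivity condition is automatic, and `γ` is determined by the other
permutations. -/
theorem ncard_transitiveFactorizations (g : ℕ) {d : ℕ} (hd : d ≠ 0) (β : Nat.Partition d) :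
    (TransitiveFactorizations g (Nat.Partition.indiscrete d) β).ncard =
      ∑ σ : Equiv.Perm (Fin d) with σ.partition.parts = β.parts, (Finset.univ.filter
        fun τ : Fin (simpleCount g (Nat.Partition.indiscrete d) β) →
            {τ : Equiv.Perm (Fin d) // τ.IsSwap} =>
          ((List.ofFn fun i => (τ i : Equiv.Perm (Fin d))).reverse.prod * σ).partition.parts =
            {d}).card := by
  rw [← Finset.card_sigma, ← Set.ncard_coe_finset]
  set r := simpleCount g (Nat.Partition.indiscrete d) β with hr
  symm
  refine Set.ncard_congr (fun p _ => (p.1, fun i => (p.2 i : Equiv.Perm (Fin d)),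
    (List.ofFn fun i => (p.2 i : Equiv.Perm (Fin d))).reverse.prod * p.1)) ?_ ?_ ?_
  · rintro ⟨σ, τ⟩ h
    simp only [Finset.coe_sigma, Set.mem_sigma_iff, Finset.coe_filter, Finset.mem_univ, true_and,
      Set.mem_ofPred_eq] at h
    refine ⟨h.1, ?_, fun i => (τ i).2, rfl, isPretransitive_of_long_cycle ?_ h.2⟩
    · rw [Nat.Partition.indiscrete_parts hd]
      exact h.2
    · refine mul_mem (list_prod_mem ?_) (Subgroup.subset_closure (Set.mem_insert _ _))
      intro x hx
      rw [List.mem_reverse, List.mem_ofFn] at hx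
      exact Subgroup.subset_closure (Set.mem_insert_of_mem _ hx)
  · rintro ⟨σ, τ⟩ ⟨σ', τ'⟩ _ _ h
    simp only [Prod.mk.injEq] at h
    obtain ⟨rfl, h2, _⟩ := h
    congr 1
    funext i
    exact Subtype.ext (congrFun h2 i)
  · rintro ⟨σ, τ, γ⟩ ⟨h1, h2, h3, h4, _⟩
    simp only at h1 h2 h3 h4
    rw [Nat.Partition.indiscrete_parts hd] at h2
    refine ⟨⟨σ, fun i => ⟨τ i, h3 i⟩⟩, ?_, ?_⟩
    · simp only [Finset.coe_sigma, Set.mem_sigma_iff, Finset.coe_filter, Finset.mem_univ, true_and,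
        Set.mem_ofPred_eq]
      exact ⟨h1, by rw [h4]; exact h2⟩
    · simp [h4]

theorem autCard_ne_zero {d : ℕ} (β : Nat.Partition d) : (autCard β : ℚ) ≠ 0 := by
  rw [Nat.cast_ne_zero, autCard, Finset.prod_ne_zero_iff]
  exact fun i _ => Nat.factorial_ne_zero _

theorem parts_ne_zero {d : ℕ} (hd : d ≠ 0) (β : Nat.Partition d) : β.parts ≠ 0 := by
  intro h
  have := β.parts_sum
  rw [h] at this
  exact hd this.symm

/-- The closed formula for one-part double Hurwitz numbers. -/
theorem doubleHurwitz_div (g : ℕ) {d : ℕ} (hd : d ≠ 0) (β : Nat.Partition d) :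
    doubleHurwitz g (Nat.Partition.indiscrete d) β /
        ((simpleCount g (Nat.Partition.indiscrete d) β).factorial * autCard β) =
      (d : ℚ) ^ (2 * (g : ℤ) - 2 + len β) * (sinhCoeff g β.parts / autCard β) := by
  classical
  have : NeZero d := ⟨hd⟩
  have hl : 0 < len β := Multiset.card_pos.2 (parts_ne_zero hd β)
  have hr : simpleCount g (Nat.Partition.indiscrete d) β = 2 * g + (β.parts.card - 1) := by
    rw [simpleCount, len, Nat.Partition.indiscrete_parts hd, Multiset.card_singleton]
    rw [len] at *
    omega
  have hd0 : (d : ℚ) ≠ 0 := by exact_mod_cast hd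
  have hN : (d : ℚ) * (TransitiveFactorizations g (Nat.Partition.indiscrete d) β).ncard =
      (Finset.univ.filter fun σ : Equiv.Perm (Fin d) => σ.partition.parts = β.parts).card *
      ((d : ℚ) ^ (2 * g + (β.parts.card - 1)) *
        ((simpleCount g (Nat.Partition.indiscrete d) β).factorial *
        (β.parts.prod * sinhCoeff g β.parts))) := by
    rw [ncard_transitiveFactorizations g hd, Nat.cast_sum, Finset.mul_sum, ← nsmul_eq_mul,
      ← Finset.sum_const]
    refine Finset.sum_congr rfl fun σ hσ => ?_
    rw [Finset.mem_filter] at hσ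
    have h := card_completions (simpleCount g (Nat.Partition.indiscrete d) β) σ
    simp only [Fintype.card_fin] at h
    rw [h, hσ.2]
    have h2 := coeff_expEval_hookPoly g (parts_ne_zero hd β)
    rw [β.parts_sum] at h2
    rw [hr, h2]
  have hC := congrArg (Nat.cast (R := ℚ)) (card_parts_eq_mul β)
  rw [Nat.cast_mul, Nat.cast_mul] at hC
  have hf : ((simpleCount g (Nat.Partition.indiscrete d) β).factorial : ℚ) ≠ 0 := by positivity
  have hdf : (d.factorial : ℚ) ≠ 0 := by positivity
  have ha := autCard_ne_zero β
  have haα : autCard (Nat.Partition.indiscrete d) = 1 := by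
    simp [autCard, Nat.Partition.indiscrete_parts hd]
  have hz : (d : ℚ) ^ (2 * (g : ℤ) - 2 + len β) = (d : ℚ) ^ (2 * g + (β.parts.card - 1)) / d := by
    rw [eq_div_iff hd0, ← zpow_natCast, ← zpow_add_one₀ hd0]
    congr 1
    rw [len] at *
    push_cast [Nat.cast_sub (show 1 ≤ β.parts.card from hl)]
    ring
  rw [hz, doubleHurwitz, haα, Nat.cast_one, one_mul]
  field_simp
  linear_combination (autCard β : ℚ) * hN + (d : ℚ) ^ (2 * g + (β.parts.card - 1)) *
    (simpleCount g (Nat.Partition.indiscrete d) β).factorial * sinhCoeff g β.parts * hC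

/-! ### The exponential formula -/

section
variable {R : Type*} [CommRing R] [Algebra ℚ R]

/-- `[t ^ d] exp (∑ₙ aₙ tⁿ)`, written as a sum over the partitions of `d`. The value `a 0` is
irrelevant. -/
def expSum (a : ℕ → R) (d : ℕ) : R :=
  ∑ β : Nat.Partition d, (autCard β : ℚ)⁻¹ • (β.parts.map a).prod

theorem expSum_zero (a : ℕ → R) : expSum a 0 = 1 := by
  simp [expSum, autCard]

theorem autCard_partitionWithPartEquiv_symm {d n : ℕ} (hn : 1 ≤ n) (hnd : n ≤ d)
    (θ : Nat.Partition (d - n)) :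
    autCard ((Nat.Partition.partitionWithPartEquiv hn hnd).symm θ).1 =
      (θ.parts.count n + 1) * autCard θ := by
  rw [autCard, autCard, Nat.Partition.partitionWithPartEquiv_symm_apply_parts]
  set s := θ.parts
  have h : ∏ i ∈ s.toFinset, (s.count i).factorial =
      ∏ i ∈ insert n s.toFinset, (s.count i).factorial := by
    refine Finset.prod_subset (Finset.subset_insert _ _) fun i _ hi => ?_
    rw [Multiset.mem_toFinset] at hi
    rw [Multiset.count_eq_zero_of_notMem hi, Nat.factorial_zero]
  rw [h, Multiset.toFinset_cons, ← Finset.mul_prod_erase _ _ (Finset.mem_insert_self n _),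
    ← Finset.mul_prod_erase _ (fun i => (s.count i).factorial) (Finset.mem_insert_self n _),
    Multiset.count_cons_self, Nat.factorial_succ, mul_assoc]
  congr 2
  refine Finset.prod_congr rfl fun i hi => ?_
  rw [Multiset.count_cons_of_ne (Finset.ne_of_mem_erase hi)]

/-- Removing a part: the sum over all partitions of `d` with a marked part. -/
theorem sum_marked_part (a c : ℕ → R) (d : ℕ) :
    ∑ β : Nat.Partition d, (autCard β : ℚ)⁻¹ •
      (β.parts.map fun n => c n * ((β.parts.erase n).map a).prod).sum =
      ∑ p ∈ Finset.HasAntidiagonal.antidiagonal d, (if p.1 = 0 then 0 else c p.1) * expSum a p.2 := by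
  have h1 : ∀ β : Nat.Partition d,
      (β.parts.map fun n => c n * ((β.parts.erase n).map a).prod).sum =
      ∑ n ∈ Finset.Ico 1 (d + 1),
        β.parts.count n • (c n * ((β.parts.erase n).map a).prod) := by
    intro β
    rw [Finset.sum_multiset_map_count]
    refine Finset.sum_subset (fun n hn => ?_) fun n _ hn => ?_
    · rw [Multiset.mem_toFinset] at hn
      rw [Finset.mem_Ico]
      have h1 := β.parts_pos hn
      have h2 := Nat.Partition.le_of_mem_parts hn
      omega
    · rw [Multiset.mem_toFinset] at hn
      rw [Multiset.count_eq_zero_of_notMem hn, zero_smul]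
  simp only [h1, Finset.smul_sum]
  rw [Finset.sum_comm, Finset.Nat.sum_antidiagonal_eq_sum_range_succ_mk, Finset.range_eq_Ico,
    Finset.sum_eq_sum_Ico_succ_bot (Nat.succ_pos d), if_pos rfl, zero_mul, zero_add]
  refine Finset.sum_congr rfl fun n hn => ?_
  rw [Finset.mem_Ico] at hn
  have hn1 : 1 ≤ n := hn.1
  have hnd : n ≤ d := by omega
  rw [if_neg (by omega)]
  have h2 : ∀ β ∈ Finset.univ, β ∉ Finset.univ.filter (fun β : Nat.Partition d => n ∈ β.parts) →
      (autCard β : ℚ)⁻¹ • β.parts.count n • (c n * ((β.parts.erase n).map a).prod) = 0 := by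
    intro β _ hβ
    have : n ∉ β.parts := by simpa using hβ
    rw [Multiset.count_eq_zero_of_notMem this, zero_smul, smul_zero]
  rw [← Finset.sum_subset (Finset.subset_univ _) h2,
    Finset.sum_subtype (p := fun β : Nat.Partition d => n ∈ β.parts) _ (by simp),
    ← (Nat.Partition.partitionWithPartEquiv hn1 hnd).symm.sum_comp, expSum, Finset.mul_sum]
  refine Finset.sum_congr rfl fun θ _ => ?_
  rw [autCard_partitionWithPartEquiv_symm, Nat.Partition.partitionWithPartEquiv_symm_apply_parts,
    Multiset.erase_cons_head, Multiset.count_cons_self, ← Nat.cast_smul_eq_nsmul ℚ, smul_smul,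
    mul_smul_comm]
  congr 1
  have := autCard_ne_zero θ
  have h3 : ((θ.parts.count n : ℚ) + 1) ≠ 0 := by positivity
  push_cast
  field_simp

/-- The recursion satisfied by the coefficients of an exponential series. -/
theorem natCast_mul_expSum (a : ℕ → R) (d : ℕ) :
    (d : R) * expSum a d = ∑ p ∈ Finset.HasAntidiagonal.antidiagonal d, p.1 * a p.1 * expSum a p.2 := by
  have h := sum_marked_part a (fun n => n * a n) d
  have h1 : ∀ p : ℕ × ℕ, (if p.1 = 0 then 0 else (p.1 : R) * a p.1) = p.1 * a p.1 := by
    intro p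
    split_ifs with hp <;> simp [hp]
  simp only [h1] at h
  rw [← h, expSum, Finset.mul_sum]
  refine Finset.sum_congr rfl fun β _ => ?_
  rw [mul_smul_comm]
  congr 1
  have h2 : β.parts.map (fun n : ℕ => (n : R) * a n * ((β.parts.erase n).map a).prod) =
      β.parts.map (fun n : ℕ => (n : R) * (β.parts.map a).prod) :=
    Multiset.map_congr rfl fun n hn => by rw [mul_assoc, Multiset.prod_map_erase hn]
  rw [h2, Multiset.sum_map_mul_right, ← Nat.cast_multiset_sum, β.parts_sum]

theorem derivation_multiset_prod (D : Derivation ℚ R R) (a : ℕ → R) (s : Multiset ℕ) :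
    D (s.map a).prod = (s.map fun n => D (a n) * ((s.erase n).map a).prod).sum := by
  induction s using Multiset.induction with
  | empty => simp
  | cons m s ih =>
    rw [Multiset.map_cons, Multiset.prod_cons, D.leibniz, ih, Multiset.map_cons, Multiset.sum_cons,
      Multiset.erase_cons_head, smul_eq_mul, smul_eq_mul, add_comm, mul_comm]
    congr 1
    rw [← Multiset.sum_map_mul_left]
    refine congrArg _ (Multiset.map_congr rfl fun n hn => ?_)
    rw [Multiset.erase_cons_tail_of_mem hn, Multiset.map_cons, Multiset.prod_cons]
    ring

/-- The chain rule `D (exp A) = D A * exp A`, coefficientwise. -/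
theorem derivation_expSum (D : Derivation ℚ R R) (a : ℕ → R) (d : ℕ) :
    D (expSum a d) = ∑ p ∈ Finset.HasAntidiagonal.antidiagonal d,
      (if p.1 = 0 then 0 else D (a p.1)) * expSum a p.2 := by
  rw [← sum_marked_part a (fun n => D (a n)) d, expSum, map_sum]
  refine Finset.sum_congr rfl fun β _ => ?_
  rw [D.map_smul, derivation_multiset_prod]

end

/-! ### Exchanging the two variables -/

section
variable {R : Type*} [CommRing R] [Algebra ℚ R]

/-- The Euler operator `t d/dt`, as a derivation over `ℚ`. -/
def eulerDer : Derivation ℚ (PowerSeries R) (PowerSeries R) :=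
  (X : PowerSeries R) • (derivative R).restrictScalars ℚ

theorem eulerDer_apply (f : PowerSeries R) : eulerDer f = X * derivative R f := rfl

theorem coeff_eulerDer (f : PowerSeries R) (d : ℕ) :
    coeff d (eulerDer f) = (d : R) * coeff d f := by
  rw [eulerDer_apply]
  rcases d with _ | d
  · simp
  · rw [coeff_succ_X_mul, coeff_derivative, mul_comm]
    push_cast
    rfl

/-- Both sides are the coefficient of `t ^ d Y ^ j` in `exp (∑ₙ ∑ᵢ c n i tⁿ Yⁱ)`; `ψ` plays the
role of `exp (∑ₙ c n 0 tⁿ)`. -/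
theorem coeff_expSum_comm (c : ℕ → ℕ → R) (hc : ∀ i, c 0 i = 0) (ψ : PowerSeries R)
    (hψ0 : constantCoeff ψ = 1) (hψ : eulerDer ψ = eulerDer (mk fun n => c n 0) * ψ) (d j : ℕ) :
    coeff j (expSum (fun n => mk (c n)) d) =
      coeff d (ψ * expSum (fun i => mk fun n => c n i) j) := by
  set b : ℕ → PowerSeries R := fun i => mk fun n => c n i with hb
  have hrec : ∀ j, eulerDer (ψ * expSum b j) = ∑ q ∈ Finset.HasAntidiagonal.antidiagonal j,
      eulerDer (b q.1) * (ψ * expSum b q.2) := by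
    intro j
    have hz : ∀ q : ℕ × ℕ, eulerDer (b q.1) * (ψ * expSum b q.2) =
        (if q.1 = 0 then eulerDer (b 0) * (ψ * expSum b q.2) else 0) +
        ψ * ((if q.1 = 0 then 0 else eulerDer (b q.1)) * expSum b q.2) := by
      rintro ⟨q, q'⟩
      by_cases hq : q = 0
      · simp [hq]
      · simp only [hq, if_false]
        ring
    simp only [hz]
    rw [Finset.sum_add_distrib, ← Finset.mul_sum, ← derivation_expSum, eulerDer.leibniz, hψ,
      Finset.sum_eq_single (0, j)]
    · simp only [smul_eq_mul, if_true, hb]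
      ring
    · rintro ⟨q, q'⟩ hq hne
      rw [Finset.HasAntidiagonal.mem_antidiagonal] at hq
      rw [if_neg]
      rintro rfl
      exact hne (by simp_all)
    · intro h
      simp at h
  -- Both sides satisfy the recursion obtained by applying `t d/dt` to the double exponential.
  induction d using Nat.strong_induction_on generalizing j with
  | _ d ih =>
    rcases Nat.eq_zero_or_pos d with rfl | hd
    · rw [expSum_zero, coeff_zero_eq_constantCoeff_apply, map_mul, hψ0, one_mul]
      rcases Nat.eq_zero_or_pos j with rfl | hj
      · simp [expSum_zero]
      · rw [coeff_one, if_neg hj.ne', expSum, map_sum]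
        symm
        refine Finset.sum_eq_zero fun θ _ => ?_
        have : constantCoeff (θ.parts.map b).prod = 0 := by
          obtain ⟨i, hi⟩ := Multiset.exists_mem_of_ne_zero (parts_ne_zero hj.ne' θ)
          rw [map_multiset_prod, Multiset.map_map]
          refine Multiset.prod_eq_zero (Multiset.mem_map.2 ⟨i, hi, ?_⟩)
          simp [hb, ← coeff_zero_eq_constantCoeff_apply, hc]
        rw [map_rat_smul, this, smul_zero]
    · have h1 := congrArg (coeff j) (natCast_mul_expSum (fun n => (mk (c n) : PowerSeries R)) d)
      have h2 := congrArg (coeff d) (hrec j)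
      rw [coeff_eulerDer, map_sum] at h2
      rw [← map_natCast (C : R →+* PowerSeries R), coeff_C_mul, map_sum] at h1
      have hreg : IsUnit (d : R) := by
        rw [← map_natCast (algebraMap ℚ R)]
        exact (IsUnit.mk0 _ (by exact_mod_cast hd.ne')).map _
      apply hreg.mul_left_cancel
      rw [h1, h2]
      simp only [coeff_mul d]
      rw [Finset.sum_comm]
      refine Finset.sum_congr rfl fun p hp => ?_
      rw [Finset.HasAntidiagonal.mem_antidiagonal] at hp
      rw [coeff_mul]
      refine Finset.sum_congr rfl fun q _ => ?_
      rw [coeff_eulerDer, ← map_natCast (C : R →+* PowerSeries R), coeff_C_mul, coeff_mk]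
      rcases Nat.eq_zero_or_pos p.1 with h0 | h0
      · simp [h0]
      · rw [ih p.2 (by omega)]
        simp [hb]

end

/-! ### Lagrange inversion -/

theorem constantCoeff_QDer (i : ℕ) : constantCoeff (QDer i) = 0 := by
  rw [← coeff_zero_eq_constantCoeff_apply, QDer, coeff_iterate_euler]
  simp [Q]

theorem constantCoeff_Q : constantCoeff Q = 0 := constantCoeff_QDer 0

/-- The series `φ = exp Q`. -/
def expQ : PowerSeries QRing := (PowerSeries.exp QRing).subst Q

theorem hasSubst_Q : HasSubst Q := HasSubst.of_constantCoeff_zero' constantCoeff_Q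

theorem constantCoeff_expQ : constantCoeff expQ = 1 := by
  have h : expQ - 1 = (PowerSeries.exp QRing - 1).subst Q := by
    rw [subst_sub hasSubst_Q, expQ, ← coe_substAlgHom hasSubst_Q, map_one]
  have h2 : constantCoeff (expQ - 1) = 0 := by
    rw [h]
    exact constantCoeff_subst_eq_zero constantCoeff_Q _ (by simp)
  rw [map_sub, map_one, sub_eq_zero] at h2
  exact h2

theorem eulerDer_expQ : eulerDer expQ = QDer 1 * expQ := by
  rw [eulerDer_apply, expQ, derivative_subst hasSubst_Q, derivative_exp, QDer,
    Function.iterate_one, euler]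
  ring

theorem eulerDer_expQ_pow (m : ℕ) :
    eulerDer (expQ ^ m) = (m : PowerSeries QRing) * QDer 1 * expQ ^ m := by
  rw [eulerDer.leibniz_pow, eulerDer_expQ]
  rcases m with _ | m
  · simp
  · simp only [Nat.add_sub_cancel, nsmul_eq_mul, smul_eq_mul, pow_succ]
    ring

/-- `φ ^ m (1 - t φ'/φ) = φ ^ m - m⁻¹ t d/dt φ ^ m`, and `t d/dt` multiplies the coefficient of `t ^ m`
by `m`. -/
theorem coeff_expQ_pow_mul (m : ℕ) :
    coeff m (expQ ^ m * (1 - QDer 1)) = if m = 0 then 1 else 0 := by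
  split_ifs with hm
  · simp [hm, constantCoeff_QDer]
  · have h := congrArg (coeff m) (eulerDer_expQ_pow m)
    rw [coeff_eulerDer, mul_assoc, ← map_natCast (C : QRing →+* PowerSeries QRing),
      coeff_C_mul] at h
    have hm' : (m : QRing) ≠ 0 := by exact_mod_cast hm
    rw [mul_sub, mul_one, map_sub, sub_eq_zero, mul_comm (expQ ^ m)]
    exact mul_left_cancel₀ hm' h

/-- The inverse of `exp Q`. -/
def expQInv : PowerSeries QRing := PowerSeries.invOfUnit expQ 1

theorem expQ_mul_expQInv : expQ * expQInv = 1 :=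
  PowerSeries.mul_invOfUnit _ _ (by simp [constantCoeff_expQ])

/-- The series `t / φ(t)`, of which the solution of `w = x φ(w)` is the compositional inverse. -/
def lagrangeBase : PowerSeries QRing := X * expQInv

theorem constantCoeff_lagrangeBase : constantCoeff lagrangeBase = 0 := by
  simp [lagrangeBase]

theorem isUnit_coeff_one_lagrangeBase : IsUnit (coeff 1 lagrangeBase) := by
  have h : constantCoeff expQInv = 1 := by
    have := congrArg constantCoeff expQ_mul_expQInv
    simpa [constantCoeff_expQ] using this
  have h2 : coeff 1 lagrangeBase = 1 := by
    rw [lagrangeBase, ← zero_add 1, coeff_succ_X_mul, coeff_zero_eq_constantCoeff_apply, h]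
  rw [h2]
  exact isUnit_one

theorem isLagrangeSolution_iff (w : PowerSeries QRing) :
    IsLagrangeSolution w ↔ constantCoeff w = 0 ∧ lagrangeBase.subst w = X := by
  refine and_congr_right fun hw => ?_
  have hs : HasSubst w := HasSubst.of_constantCoeff_zero' hw
  have e : (PowerSeries.exp QRing).subst (Q.subst w : PowerSeries QRing) = expQ.subst w := by
    rw [expQ, subst_comp_subst_apply hasSubst_Q hs]
  have h1 : (expQ.subst w : PowerSeries QRing) * expQInv.subst w = 1 := by
    rw [← subst_mul hs, expQ_mul_expQInv, ← coe_substAlgHom hs, map_one]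
  rw [e, lagrangeBase, subst_mul hs, subst_X hs]
  constructor
  · intro h
    have h2 := congrArg (· * (expQInv.subst w : PowerSeries QRing)) h
    rwa [mul_assoc, h1, mul_one] at h2
  · intro h
    rw [← h, mul_assoc, mul_comm (expQInv.subst w), h1, mul_one]

theorem existsUnique_isLagrangeSolution : ∃! w, IsLagrangeSolution w := by
  simp only [isLagrangeSolution_iff]
  have h0 := constantCoeff_lagrangeBase
  set v := lagrangeBase.substInvOfIsUnit isUnit_coeff_one_lagrangeBase with hv
  have hv1 : lagrangeBase.subst v = X := subst_substInvOfIsUnit_right _ h0 _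
  have hv2 : v.subst lagrangeBase = X := subst_substInvOfIsUnit_left _ h0 _
  refine ⟨v, ⟨constantCoeff_substInvOfIsUnit _ _, hv1⟩, ?_⟩
  rintro w ⟨hw0, hw⟩
  have hs : HasSubst w := HasSubst.of_constantCoeff_zero' hw0
  have h := subst_comp_subst_apply (HasSubst.of_constantCoeff_zero' h0) hs v
  rw [hv2, hw, subst_X hs, X_subst] at h
  exact h

theorem subst_lagrangeBase {w : PowerSeries QRing} (hw : IsLagrangeSolution w) :
    w.subst lagrangeBase = X := by
  have h0 := constantCoeff_lagrangeBase
  have hv1 := subst_substInvOfIsUnit_right _ h0 isUnit_coeff_one_lagrangeBase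
  have hv2 := subst_substInvOfIsUnit_left _ h0 isUnit_coeff_one_lagrangeBase
  rw [existsUnique_isLagrangeSolution.unique hw
    ((isLagrangeSolution_iff _).2 ⟨constantCoeff_substInvOfIsUnit _ _, hv1⟩), hv2]

/-- The Lagrange inversion formula in the form `[x^d] G(w) / (1 - w φ'(w)/φ(w)) = [t^d] G φ^d`. -/
theorem coeff_subst_mul_inv {w : PowerSeries QRing} (hw : IsLagrangeSolution w)
    (G : PowerSeries QRing) (d : ℕ) :
    coeff d (G.subst w * PowerSeries.invOfUnit (1 - QDerAt w 1) 1) = coeff d (G * expQ ^ d) := by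
  have hs : HasSubst w := HasSubst.of_constantCoeff_zero' hw.1
  have hh : HasSubst lagrangeBase := HasSubst.of_constantCoeff_zero' constantCoeff_lagrangeBase
  set F : PowerSeries QRing := G.subst w * PowerSeries.invOfUnit (1 - QDerAt w 1) 1 with hF
  have hFG : F * (1 - QDerAt w 1) = G.subst w := by
    rw [hF, mul_assoc, mul_comm (PowerSeries.invOfUnit _ _), one_sub_mul_inv w hw.1, mul_one]
  have hcomp : ∀ f : PowerSeries QRing,
      PowerSeries.subst lagrangeBase (f.subst w : PowerSeries QRing) = f := by
    intro f
    rw [subst_comp_subst_apply hs hh, subst_lagrangeBase hw, X_subst]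
  -- Substitute `t / φ(t)` for `x`, then expand `F` in powers of `x`.
  have hG : G = F.subst lagrangeBase * (1 - QDer 1) := by
    have h := congrArg (fun f : PowerSeries QRing => (f.subst lagrangeBase : PowerSeries QRing)) hFG
    simp only [subst_mul hh, subst_sub hh, hcomp, QDerAt] at h
    rw [← h, ← coe_substAlgHom hh, map_one]
  have hterm : ∀ k ≤ d, coeff d (lagrangeBase ^ k * (1 - QDer 1) * expQ ^ d) =
      if k = d then 1 else 0 := by
    intro k hk
    have e : lagrangeBase ^ k * (1 - QDer 1) * expQ ^ d =
        X ^ k * (expQ ^ (d - k) * (1 - QDer 1)) := by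
      have h1 : expQ ^ d = expQ ^ k * expQ ^ (d - k) := by rw [← pow_add]; congr 1; omega
      have h2 : expQ ^ k * expQInv ^ k = 1 := by rw [← mul_pow, expQ_mul_expQInv, one_pow]
      rw [h1, lagrangeBase, mul_pow]
      linear_combination X ^ k * (1 - QDer 1) * expQ ^ (d - k) * h2
    have hd : d = d - k + k := by omega
    rw [e]
    conv_lhs => rw [hd]
    rw [coeff_X_pow_mul, Nat.add_sub_cancel, coeff_expQ_pow_mul]
    congr 1
    exact propext (by omega)
  have hsplit : ∃ E : PowerSeries QRing, F.subst lagrangeBase =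
      ∑ k ∈ Finset.range (d + 1), C (coeff k F) * lagrangeBase ^ k + X ^ (d + 1) * E := by
    refine ⟨expQInv ^ (d + 1) *
      (mk fun i => coeff (i + (d + 1)) F : PowerSeries QRing).subst lagrangeBase, ?_⟩
    conv_lhs => rw [F.eq_X_pow_mul_shift_add_trunc (d + 1)]
    rw [subst_add hh, subst_mul hh, subst_pow hh, subst_X hh, subst_coe hh,
      Polynomial.aeval_eq_sum_range' (natDegree_trunc_lt F d), add_comm, ← mul_assoc, ← mul_pow]
    congr 1
    refine Finset.sum_congr rfl fun k hk => ?_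
    rw [coeff_trunc, if_pos (Finset.mem_range.1 hk), smul_eq_C_mul]
  obtain ⟨E, hE⟩ := hsplit
  rw [hG, hE, add_mul, add_mul, map_add, Finset.sum_mul, Finset.sum_mul, map_sum]
  have hz : coeff d (X ^ (d + 1) * E * (1 - QDer 1) * expQ ^ d) = 0 := by
    rw [mul_assoc, mul_assoc, coeff_X_pow_mul', if_neg (by omega)]
  rw [hz, add_zero, Finset.sum_eq_single d]
  · rw [mul_assoc, mul_assoc, coeff_C_mul, ← mul_assoc, hterm d le_rfl, if_pos rfl, mul_one]
  · intro k hk hkd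
    rw [Finset.mem_range] at hk
    rw [mul_assoc, mul_assoc, coeff_C_mul, ← mul_assoc, hterm k (by omega), if_neg hkd, mul_zero]
  · intro h
    simp at h

/-! ### Halving the exponents of even series -/

/-- The series `V` with `V(t²) = (2/t) sinh(t/2)`. -/
def sinhQuotSqrt : PowerSeries ℚ := PowerSeries.mk fun k => vCoeff (2 * k)

theorem constantCoeff_sinhQuotSqrt : constantCoeff sinhQuotSqrt = 1 := by
  rw [← coeff_zero_eq_constantCoeff_apply, sinhQuotSqrt, coeff_mk, vCoeff, mul_zero,
    coeff_zero_eq_constantCoeff_apply, constantCoeff_sinhQuot]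

theorem expand_sinhQuotSqrt : PowerSeries.expand 2 two_ne_zero sinhQuotSqrt = sinhQuot := by
  ext n
  rcases Nat.even_or_odd' n with ⟨k, rfl | rfl⟩
  · rw [coeff_expand_mul, sinhQuotSqrt, coeff_mk, vCoeff]
  · rw [coeff_expand_of_not_dvd _ _ _ (by omega), sinhQuot, coeff_mk, map_sub, coeff_rescale,
      coeff_rescale, neg_div, Even.neg_pow (by exact ⟨k + 1, by ring⟩), sub_self]

theorem expand_sinhQuotSqrt_inv :
    PowerSeries.expand 2 two_ne_zero sinhQuotSqrt⁻¹ = sinhQuot⁻¹ := by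
  have h : sinhQuot * PowerSeries.expand 2 two_ne_zero sinhQuotSqrt⁻¹ = 1 := by
    rw [← expand_sinhQuotSqrt, ← map_mul, PowerSeries.mul_inv_cancel, map_one]
    rw [constantCoeff_sinhQuotSqrt]
    exact one_ne_zero
  have h2 := sinhQuot_mul_inv
  calc _ = sinhQuot * sinhQuot⁻¹ * PowerSeries.expand 2 two_ne_zero sinhQuotSqrt⁻¹ := by
        rw [h2, one_mul]
    _ = _ := by rw [mul_right_comm, h, one_mul]

theorem fCoeff_two_mul (k : ℕ) : fCoeff (2 * k) = coeff k sinhQuotSqrt⁻¹ := by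
  rw [fCoeff, ← expand_sinhQuotSqrt_inv, coeff_expand_mul]

theorem rescale_sinhQuot (m : ℕ) :
    rescale (m : ℚ) sinhQuot =
      PowerSeries.expand 2 two_ne_zero (rescale ((m : ℚ) ^ 2) sinhQuotSqrt) := by
  rw [← expand_sinhQuotSqrt]
  ext n
  rw [coeff_rescale, coeff_expand, coeff_expand]
  split_ifs with h
  · obtain ⟨k, rfl⟩ := h
    rw [coeff_rescale, Nat.mul_div_cancel_left _ two_pos, pow_mul]
  · rw [mul_zero]

/-- `∏ₘ V(m² Y)`. -/
def sinhProd (s : Multiset ℕ) : PowerSeries ℚ :=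
  (s.map fun m : ℕ => rescale ((m : ℚ) ^ 2) sinhQuotSqrt).prod

theorem sinhCoeff_eq_sum (g : ℕ) (s : Multiset ℕ) :
    sinhCoeff g s = ∑ k ∈ Finset.range (g + 1), fCoeff (2 * k) * coeff (g - k) (sinhProd s) := by
  have h : (s.map fun m : ℕ => rescale (m : ℚ) sinhQuot).prod =
      PowerSeries.expand 2 two_ne_zero (sinhProd s) := by
    rw [sinhProd, map_multiset_prod, Multiset.map_map]
    simp only [rescale_sinhQuot, Function.comp_def]
  rw [sinhCoeff, h, ← expand_sinhQuotSqrt_inv, ← map_mul, coeff_expand_mul, coeff_mul,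
    Finset.Nat.sum_antidiagonal_eq_sum_range_succ_mk]
  simp only [fCoeff_two_mul]

/-! ### The exponent in two variables -/

/-- The coefficient of `tⁿ Yⁱ` in `N ∑ₙ qₙ V(n² Y) tⁿ`. -/
def biCoeff (N n i : ℕ) : QRing :=
  if n = 0 then 0 else MvPolynomial.C (N * (n : ℚ) ^ (2 * i) * vCoeff (2 * i)) * MvPolynomial.X n

theorem mk_biCoeff_left (N : ℕ) {n : ℕ} (hn : n ≠ 0) :
    (mk (biCoeff N n) : PowerSeries QRing) =
      C (MvPolynomial.C (N : ℚ) * MvPolynomial.X n) *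
        PowerSeries.map MvPolynomial.C (rescale ((n : ℚ) ^ 2) sinhQuotSqrt) := by
  ext1 i
  rw [coeff_mk, coeff_C_mul, coeff_map, coeff_rescale, biCoeff, if_neg hn, sinhQuotSqrt, coeff_mk,
    ← pow_mul, map_mul, map_mul, map_mul]
  ring

theorem mk_biCoeff_right (N i : ℕ) :
    (mk fun n => biCoeff N n i : PowerSeries QRing) =
      C (MvPolynomial.C (N * vCoeff (2 * i))) * QDer (2 * i) := by
  ext1 n
  rw [coeff_mk, coeff_C_mul, QDer, coeff_iterate_euler, biCoeff, Q, coeff_mk]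
  split_ifs with h
  · simp
  · simp only [map_mul, map_pow, map_natCast]
    ring

theorem coeff_expSum_biCoeff_left (N d j : ℕ) :
    coeff j (expSum (fun n => (mk (biCoeff N n) : PowerSeries QRing)) d) =
      ∑ β : Nat.Partition d, MvPolynomial.C ((N : ℚ) ^ len β *
        (coeff j (sinhProd β.parts) / autCard β)) * qMon β := by
  rw [expSum, map_sum]
  refine Finset.sum_congr rfl fun β _ => ?_
  have key : ∀ s : Multiset ℕ, (∀ n ∈ s, n ≠ 0) →
      (s.map fun n => (mk (biCoeff N n) : PowerSeries QRing)).prod =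
      C (MvPolynomial.C ((N : ℚ) ^ s.card) * (s.map MvPolynomial.X).prod) *
        PowerSeries.map MvPolynomial.C (sinhProd s) := by
    intro s hs
    induction s using Multiset.induction with
    | empty => simp [sinhProd]
    | cons m s ih =>
      have e : sinhProd (m ::ₘ s) = rescale ((m : ℚ) ^ 2) sinhQuotSqrt * sinhProd s := by
        rw [sinhProd, Multiset.map_cons, Multiset.prod_cons, sinhProd]
      rw [e, Multiset.map_cons, Multiset.prod_cons,
        ih fun n hn => hs n (Multiset.mem_cons_of_mem hn),
        mk_biCoeff_left N (hs m (Multiset.mem_cons_self m s)), Multiset.map_cons,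
        Multiset.prod_cons, Multiset.card_cons, pow_succ (N : ℚ)]
      simp only [map_mul]
      ring
  rw [key _ fun n hn => (β.parts_pos hn).ne', map_rat_smul, coeff_C_mul, coeff_map,
    MvPolynomial.smul_eq_C_mul, qMon, len, div_eq_mul_inv]
  simp only [map_mul]
  ring

theorem expSum_biCoeff_right (N j : ℕ) :
    expSum (fun i => (mk fun n => biCoeff N n i : PowerSeries QRing)) j =
      ∑ θ : Nat.Partition j, C (MvPolynomial.C ((N : ℚ) ^ len θ * (vPart θ / autCard θ))) *
        (θ.parts.map fun i => QDer (2 * i)).prod := by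
  rw [expSum]
  refine Finset.sum_congr rfl fun θ _ => ?_
  simp only [mk_biCoeff_right]
  have e : (θ.parts.map fun i => (C (MvPolynomial.C ((N : ℚ) * vCoeff (2 * i))) :
      PowerSeries QRing)).prod = C (MvPolynomial.C ((N : ℚ) ^ len θ * vPart θ)) := by
    rw [vPart, len, ← Multiset.prod_replicate, ← Multiset.map_const', ← Multiset.prod_map_mul,
      map_multiset_prod, map_multiset_prod, Multiset.map_map, Multiset.map_map]
    rfl
  have e2 : (N : ℚ) ^ len θ * (vPart θ / autCard θ) =
      (autCard θ : ℚ)⁻¹ * ((N : ℚ) ^ len θ * vPart θ) := by ring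
  rw [Multiset.prod_map_mul, e, e2, map_mul MvPolynomial.C (autCard θ : ℚ)⁻¹, map_mul C, mul_assoc]
  ext1 n
  rw [map_rat_smul, coeff_C_mul (a := MvPolynomial.C (autCard θ : ℚ)⁻¹),
    MvPolynomial.smul_eq_C_mul]

theorem eulerDer_expQ_pow_eq_biCoeff (N : ℕ) :
    eulerDer (expQ ^ N) = eulerDer (mk fun n => biCoeff N n 0) * expQ ^ N := by
  rw [eulerDer_expQ_pow]
  refine congrArg (· * expQ ^ N) ?_
  have hv : vCoeff (2 * 0) = 1 := by
    rw [vCoeff, mul_zero, coeff_zero_eq_constantCoeff_apply, constantCoeff_sinhQuot]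
  ext1 n
  rw [coeff_eulerDer, coeff_mk, ← map_natCast (C : QRing →+* PowerSeries QRing), coeff_C_mul, QDer,
    coeff_iterate_euler, Q, coeff_mk, biCoeff, hv]
  split_ifs with h
  · simp [h]
  · simp only [mul_zero, pow_zero, mul_one, map_natCast, pow_one]
    ring

/-- The coefficient of `t ^ d Y ^ j` in `exp (d ∑ₙ qₙ V(n² Y) tⁿ)`, computed by collecting first the
powers of `t`, then the powers of `Y`. The two sides are sums over partitions of `d` and of `j`. -/
theorem coeff_expSum_biCoeff (d j : ℕ) :
    coeff j (expSum (fun n => (mk (biCoeff d n) : PowerSeries QRing)) d) =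
      coeff d (expQ ^ d *
        expSum (fun i => (mk fun n => biCoeff d n i : PowerSeries QRing)) j) :=
  coeff_expSum_comm (biCoeff d) (fun i => by rw [biCoeff, if_pos rfl]) (expQ ^ d)
    (by rw [map_pow, constantCoeff_expQ, one_pow]) (eulerDer_expQ_pow_eq_biCoeff d) d j

/-! ### The genus expansion -/

theorem coeff_onePartSeries (g : ℕ) {d : ℕ} (hd : d ≠ 0) :
    coeff d (onePartSeries g) = ∑ β : Nat.Partition d,
      MvPolynomial.C ((d : ℚ) ^ (2 * (g : ℤ) - 2 + len β) *
        (sinhCoeff g β.parts / autCard β)) * qMon β := by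
  rw [onePartSeries, coeff_map, onePartSeriesU, coeff_mk, if_neg hd, map_sum]
  refine Finset.sum_congr rfl fun β _ => ?_
  rw [doubleHurwitz_div g hd, Polynomial.coe_evalRingHom, Polynomial.eval_monomial, one_pow,
    mul_one]

/-- For `d ≠ 0` the term `δ_{θ∅}` does not contribute. -/
theorem coeff_bracket {w : PowerSeries QRing} (hw : IsLagrangeSolution w) {n : ℕ}
    (θ : Nat.Partition n) {d : ℕ} (hd : d ≠ 0) :
    coeff d (bracket w θ) = coeff d ((θ.parts.map fun i => QDer (2 * i)).prod * expQ ^ d) := by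
  have hs : HasSubst w := HasSubst.of_constantCoeff_zero' hw.1
  have h : coeff d (if θ.parts = 0 then (1 : PowerSeries QRing) else 0) = 0 := by
    split_ifs <;> simp [coeff_one, hd]
  rw [bracket, map_sub, h, sub_zero, ← coeff_subst_mul_inv hw]
  congr 2
  rw [QPartAt, ← coe_substAlgHom hs, map_multiset_prod, Multiset.map_map]
  simp only [Function.comp_def, coe_substAlgHom]
  rfl

theorem onePartSeries_eq {w : PowerSeries QRing} (hw : IsLagrangeSolution w) (g : ℕ) :
    onePartSeries g = ∑ k ∈ Finset.range (g + 1), fCoeff (2 * k) •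
      ∑ θ : Nat.Partition (g - k), (vPart θ / (autCard θ : ℚ)) •
        eulerPow (2 * (g : ℤ) - 2 + (len θ : ℤ)) (bracket w θ) := by
  ext1 d
  rcases Nat.eq_zero_or_pos d with rfl | hd
  · have h1 : coeff 0 (onePartSeries g) = 0 := by
      rw [onePartSeries, coeff_map, onePartSeriesU, coeff_mk, if_pos rfl, map_zero]
    rw [h1, map_sum]
    symm
    refine Finset.sum_eq_zero fun k _ => ?_
    rw [map_rat_smul, map_sum, Finset.sum_eq_zero, smul_zero]
    intro θ _
    rw [map_rat_smul, eulerPow, coeff_mk, coeff_zero_eq_constantCoeff_apply,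
      constantCoeff_bracket w hw.1, mul_zero, smul_zero]
  have hd0 : (d : ℚ) ≠ 0 := by exact_mod_cast hd.ne'
  have hz : ∀ l : ℕ, (d : ℚ) ^ (2 * (g : ℤ) - 2 + l) = (d : ℚ) ^ (2 * (g : ℤ) - 2) * (d : ℚ) ^ l :=
    fun l => by rw [zpow_add₀ hd0, zpow_natCast]
  have hL : coeff d (onePartSeries g) = ∑ k ∈ Finset.range (g + 1),
      MvPolynomial.C ((d : ℚ) ^ (2 * (g : ℤ) - 2) * fCoeff (2 * k)) *
        coeff (g - k) (expSum (fun n => (mk (biCoeff d n) : PowerSeries QRing)) d) := by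
    rw [coeff_onePartSeries g hd.ne']
    simp only [coeff_expSum_biCoeff_left, Finset.mul_sum]
    rw [Finset.sum_comm]
    refine Finset.sum_congr rfl fun β _ => ?_
    rw [sinhCoeff_eq_sum, hz, Finset.sum_div, Finset.mul_sum, map_sum, Finset.sum_mul]
    refine Finset.sum_congr rfl fun k _ => ?_
    rw [← mul_assoc, ← map_mul]
    congr 2
    ring
  rw [hL, map_sum]
  refine Finset.sum_congr rfl fun k _ => ?_
  rw [coeff_expSum_biCoeff, expSum_biCoeff_right, map_rat_smul, Finset.mul_sum, map_sum, map_sum,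
    Finset.mul_sum, Finset.smul_sum]
  refine Finset.sum_congr rfl fun θ _ => ?_
  rw [map_rat_smul, eulerPow, coeff_mk, coeff_bracket hw θ hd.ne', mul_left_comm, coeff_C_mul,
    mul_comm (expQ ^ d), hz, MvPolynomial.smul_eq_C_mul, MvPolynomial.smul_eq_C_mul]
  simp only [map_mul]
  ring

end OnePartHurwitz

end

theorem theorem3p9 :
    (∃! w : PowerSeries OnePartHurwitz.QRing, OnePartHurwitz.IsLagrangeSolution w) ∧
    ∀ w : PowerSeries OnePartHurwitz.QRing, OnePartHurwitz.IsLagrangeSolution w →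
      ∀ g : ℕ,
        OnePartHurwitz.onePartSeries g =
          ∑ k ∈ Finset.range (g + 1),
            OnePartHurwitz.fCoeff (2 * k) •
              ∑ θ : Nat.Partition (g - k),
                (OnePartHurwitz.vPart θ / (OnePartHurwitz.autCard θ : ℚ)) •
                  OnePartHurwitz.eulerPow (2 * (g : ℤ) - 2 + (OnePartHurwitz.len θ : ℤ))
                    (OnePartHurwitz.bracket w θ) :=
  ⟨OnePartHurwitz.existsUnique_isLagrangeSolution,
    fun _ hw g => OnePartHurwitz.onePartSeries_eq hw g⟩
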